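/- Let $m_1,\dots,m_M$ be men and $w_1,\dots,w_W$ be women. A preference list of a person is a strict total order on the set consisting of all persons of the opposite sex and of the option of staying single; a person is acceptable if ranked before that option. In a matching every person is single or matched to one person of the opposite sex. A matching is stable if nobody prefers being single to their assigned partner and no man and woman prefer each other to what the matching assigns to them. A man is a stable partner of a woman if they are matched in at least one stable matching. The men's preference lists are arbitrary (fixed). Each woman $w$ has a fixed set of acceptable men, and the women draw their preference lists $\succ_w$ independently from distributions that are regular: for all sequences $a_1,a_2,\dots,a_k$ ($k\ge 2$) of men acceptable to $w$ such that $\mathbb P[a_2\succ_w\dots\succ_w a_k]>0$, $$\mathbb P[a_1\succ_w a_2\mid a_2\succ_w\dots\succ_w a_k]\le\mathbb P[a_1\succ_w a_2].$$ For $k\ge1$ let $$u_k=\max_{w,i}\left\{\frac{\mathbb P[m_{i+k}\succ_w m_i]}{\mathbb P[m_i\succ_w m_{i+k}]}\;\middle|\; w\text{ finds both }m_i\text{ and }m_{i+k}\text{ acceptable}\right\}\in[0,\infty],$$ where a maximum over the empty set is $0$ and a ratio with denominator $0$ is $\infty$. Then, for each woman $w$ who has a stable partner with positive probability, conditionally on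 the event that she has at least one stable partner, the expected value of the largest difference of ranks in her preference list between two of her stable partners is at most $$\Bigl(1+2\exp\Bigl(\sum_{k\ge1}k\,u_k\Bigr)\Bigr)\sum_{k\ge1}k^2u_k ,$$ where this bound is $\infty$ if some $u_k$ is. -/

import Mathlib

open MeasureTheory ProbabilityTheory
open scoped ENNReal

namespace StableMarriage

/-- A preference list of a person facing `n` persons of the opposite sex: a strict total order on
these `n` persons together with the option `none` of staying single. It is encoded by the bijection
that sends each option to its position in the order, position `0` being the favourite option. -/
def PrefList (n : ℕ) : Type := Option (Fin n) ≃ Fin (n + 1)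

namespace PrefList

variable {n : ℕ}

noncomputable instance : Fintype (PrefList n) :=
  inferInstanceAs (Fintype (Option (Fin n) ≃ Fin (n + 1)))

instance : MeasurableSpace (PrefList n) := ⊤

instance : DiscreteMeasurableSpace (PrefList n) := ⟨fun _ => trivial⟩

/-- The position of an option in a preference list. -/
def pos (p : PrefList n) (x : Option (Fin n)) : ℕ := (Equiv.toFun p x : Fin (n + 1))

/-- `p.Prefers x y`: the option `x` is ranked strictly before the option `y`. -/
def Prefers (p : PrefList n) (x y : Option (Fin n)) : Prop := p.pos x < p.pos y

/-- A potential partner is acceptable when ranked before the option of staying single. -/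
def Accepts (p : PrefList n) (a : Fin n) : Prop := p.Prefers (some a) none

end PrefList

/-- A matching between `M` men and `W` women; `none` means single. -/
structure Matching (M W : ℕ) where
  wife : Fin M → Option (Fin W)
  husband : Fin W → Option (Fin M)
  consistent : ∀ m w, wife m = some w ↔ husband w = some m

/-- A matching is stable when nobody prefers being single to the assigned partner, and no man and
woman prefer each other to what the matching assigns to them. -/
def Matching.IsStable {M W : ℕ} (μ : Matching M W)
    (men : Fin M → PrefList W) (women : Fin W → PrefList M) : Prop :=
  (∀ m, ¬ (men m).Prefers none (μ.wife m)) ∧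
  (∀ w, ¬ (women w).Prefers none (μ.husband w)) ∧
  (∀ m w, ¬ ((women w).Prefers (some m) (μ.husband w) ∧ (men m).Prefers (some w) (μ.wife m)))

/-- The men who are matched to `w` in at least one stable matching. -/
def stablePartners {M W : ℕ} (men : Fin M → PrefList W) (women : Fin W → PrefList M)
    (w : Fin W) : Set (Fin M) :=
  {m | ∃ μ : Matching M W, μ.IsStable men women ∧ μ.husband w = some m}

/-- The largest difference of ranks, in the preference list of `w`, between two of her stable
partners (`0` if she has none). -/
noncomputable def stableRankGap {M W : ℕ} (men : Fin M → PrefList W)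
    (women : Fin W → PrefList M) (w : Fin W) : ℝ≥0∞ :=
  ⨆ m ∈ stablePartners men women w, ⨆ m' ∈ stablePartners men women w,
    ((((women w).pos (some m) : ℤ) - ((women w).pos (some m') : ℤ)).natAbs : ℝ≥0∞)

/-- The event that `a` is ranked before `b`. -/
def rankedBefore {n : ℕ} (a b : Fin n) : Set (PrefList n) := {p | p.Prefers (some a) (some b)}

/-- The event that the members of the sequence `l` are ranked in the order of the sequence. -/
def rankedInOrder {n : ℕ} (l : List (Fin n)) : Set (PrefList n) :=
  {p | l.IsChain fun a b => p.Prefers (some a) (some b)}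

/-- A distribution `D` of preference lists whose set of acceptable partners is `A` is regular when
`P[a₁ ≻ a₂ | a₂ ≻ ⋯ ≻ aₖ] ≤ P[a₁ ≻ a₂]` for all sequences `a₁, …, aₖ` of acceptable partners
(the conditional probability is read as `0` when the conditioning event has probability `0`,
so such sequences impose nothing). -/
def IsRegular {n : ℕ} (D : Measure (PrefList n)) (A : Set (Fin n)) : Prop :=
  ∀ (a₁ a₂ : Fin n) (l : List (Fin n)), a₁ ∈ A → a₂ ∈ A → (∀ a ∈ l, a ∈ A) →
    (cond D (rankedInOrder (a₂ :: l))) (rankedBefore a₁ a₂) ≤ D (rankedBefore a₁ a₂)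

/-- The largest odds, over all women `w` and all `i` such that `w` finds both `i` and `i + k`
acceptable, that `w` ranks man `i + k` before man `i`. It is `∞` if one of these odds is infinite,
and `0` if there are no such `w` and `i`. -/
noncomputable def maxOdds {M W : ℕ} (D : Fin W → Measure (PrefList M)) (A : Fin W → Set (Fin M))
    (k : ℕ) : ℝ≥0∞ :=
  ⨆ (w : Fin W) (i : Fin M) (j : Fin M) (_ : (j : ℕ) = i + k) (_ : i ∈ A w) (_ : j ∈ A w),
    D w (rankedBefore j i) / D w (rankedBefore i j)

end StableMarriage

namespace StableMarriage

/-! Let `μ` be the man-optimal stable matching, and let each woman `v` reveal only how she orders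
the acceptable men who weakly prefer her to their `μ`-assignment. This information determines `μ`
(`Matching.IsManOptimal.of_agree`). Conditioning on it keeps the lists independent
(`cond_pi_univ_pi`) and puts her husband first among the revealed men. Regularity therefore still
bounds by `u_{j-i}` the probability that an acceptable man `j > i` is ranked before the husband `i`.

Call `s` a cut if every woman whose husband has index less than `s` ranks him before all acceptable
men of index at least `s`. The men below a cut have the same set of wives in all stable matchings.
Let `w` have husband `x` and let `s ≤ x` be the last cut. Then all stable partners of `w` have index
at least `s`, and `x` is the one she likes least. The men she ranks between her best stable partner
and `x` are of three kinds (`stableRankGap_le_counts`): those of index above `x`, of expected number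
at most `U = ∑ k u_k`; those of index in `[s, x)`, at most `x - s` many; and those of index below
`s`, each giving an inversion across the cut, of expected number at most `U`.

The main estimate, `lintegral_sub_lastCut_le`, bounds the expectation of `x - s` by `exp U * K` with
`K = ∑ k² u_k`. Since `U ≤ K` and `1 ≤ exp U`, the total is at most `(1 + 2 exp U) K`. Averaging
over the revealed information finishes the proof. -/

/-! ### Man-optimal stable matchings and separators. -/

theorem PrefList.pos_injective {n : ℕ} (p : PrefList n) : Function.Injective p.pos :=
  fun _ _ h => Equiv.injective (α := Option (Fin n)) (β := Fin (n + 1)) p (Fin.ext h)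

theorem exists_preferred {n : ℕ} (p : PrefList n) {s : Set (Option (Fin n))} (hs : s.Nonempty) :
    ∃ o ∈ s, ∀ o' ∈ s, p.pos o ≤ p.pos o' :=
  Set.exists_min_image s p.pos s.toFinite hs

/-- Each man weakly prefers `μ` to every stable matching. -/
def Matching.IsManOptimal {M W : ℕ} (μ : Matching M W)
    (men : Fin M → PrefList W) (women : Fin W → PrefList M) : Prop :=
  ∀ ν : Matching M W, ν.IsStable men women → ∀ m, (men m).pos (μ.wife m) ≤ (men m).pos (ν.wife m)

/-- Deferred acceptance as a least fixed point: `R` is the set of rejections, and `c R m` is the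
favourite option of `m` that has not rejected him. More rejections push men further down their
lists, which causes more rejections, so `F` is monotone. -/
theorem exists_isStable_isManOptimal {M W : ℕ} (men : Fin M → PrefList W)
    (women : Fin W → PrefList M) :
    ∃ μ : Matching M W, μ.IsStable men women ∧ μ.IsManOptimal men women := by
  classical
  let avail : Set (Fin M × Fin W) → Fin M → Set (Option (Fin W)) :=
    fun R m => {o | ∀ v, o = some v → (m, v) ∉ R}
  have havail : ∀ R m, none ∈ avail R m := fun R m v h => by simp at h
  choose c hc hmin using fun R m => exists_preferred (men m) ⟨none, havail R m⟩
  let F : Set (Fin M × Fin W) →o Set (Fin M × Fin W) :=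
    { toFun := fun R => {x | (women x.2).Prefers none (some x.1) ∨
        ∃ m', (men m').pos (some x.2) ≤ (men m').pos (c R m') ∧
          (women x.2).Prefers (some m') (some x.1)}
      monotone' := by
        intro R R' h x hx
        rcases hx with hx | ⟨m', h1, h2⟩
        · exact Or.inl hx
        · refine Or.inr ⟨m', h1.trans (hmin R m' _ ?_), h2⟩
          intro v hv hR
          exact hc R' m' v hv (h hR) }
  let R := F.lfp
  have hR : F R = R := F.map_lfp
  have memR : ∀ m v, (m, v) ∈ R ↔ ((women v).Prefers none (some m) ∨
      ∃ m', (men m').pos (some v) ≤ (men m').pos (c R m') ∧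
        (women v).Prefers (some m') (some m)) := by
    intro m v
    conv_lhs => rw [← hR]
    rfl
  have hcR : ∀ m v, c R m = some v → ¬ (women v).Prefers none (some m) ∧
      ∀ m', (men m').pos (some v) ≤ (men m').pos (c R m') →
        ¬ (women v).Prefers (some m') (some m) := by
    intro m v h
    have := hc R m v h
    rw [memR] at this
    push Not at this
    exact this
  have huniq : ∀ m m' v, c R m = some v → c R m' = some v → m = m' := by
    intro m m' v h h'
    have h1 := (hcR m v h).2 m' (by rw [h'])
    have h2 := (hcR m' v h').2 m (by rw [h])
    have := (women v).pos_injective (le_antisymm (not_lt.1 h1) (not_lt.1 h2))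
    simpa using this
  let μ : Matching M W :=
    { wife := c R
      husband := fun v => if h : ∃ m, c R m = some v then some h.choose else none
      consistent := by
        intro m v
        constructor
        · intro h
          have hex : ∃ m, c R m = some v := ⟨m, h⟩
          simp only [hex, dif_pos]
          exact congrArg some (huniq _ _ v hex.choose_spec h)
        · intro h
          by_cases hex : ∃ m, c R m = some v
          · simp only [hex, dif_pos, Option.some.injEq] at h
            exact h ▸ hex.choose_spec
          · simp [hex] at h }
  have hμ : ∀ m v, c R m = some v ↔ μ.husband v = some m := μ.consistent
  have hacc : ∀ v, ¬ (women v).Prefers none (μ.husband v) := by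
    intro v h
    cases hh : μ.husband v with
    | none => rw [hh] at h; exact lt_irrefl _ h
    | some m => rw [hh] at h; exact (hcR m v ((hμ m v).2 hh)).1 h
  refine ⟨μ, ⟨?_, hacc, ?_⟩, ?_⟩
  · intro m h
    exact absurd (hmin R m none (havail R m)) (not_le.2 h)
  · rintro m v ⟨h1, h2⟩
    have hm : (women v).pos (some m) ≤ (women v).pos none :=
      (lt_of_lt_of_le h1 (not_lt.1 (hacc v))).le
    -- `m0` is the man `v` likes best among the acceptable men who weakly prefer her to their
    -- assignment. Only a better such man could make her reject him, so he is her husband and `m`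
    -- cannot be better.
    obtain ⟨m0, ⟨h0, h0'⟩, hm0⟩ := Set.exists_min_image
      {m | (men m).pos (some v) ≤ (men m).pos (c R m) ∧
        (women v).pos (some m) ≤ (women v).pos none} (fun m => (women v).pos (some m))
      (Set.toFinite _) ⟨m, h2.le, hm⟩
    have hcm0 : c R m0 = some v := by
      by_contra hne
      have hlt : (men m0).pos (some v) < (men m0).pos (c R m0) :=
        lt_of_le_of_ne h0 fun h => hne ((men m0).pos_injective h).symm
      have hin : (m0, v) ∈ R := by
        by_contra hnot
        refine absurd (hmin R m0 (some v) ?_) (not_le.2 hlt)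
        rintro v' hv'
        cases hv'
        exact hnot
      rcases (memR m0 v).1 hin with h | ⟨m', h3, h4⟩
      · exact absurd h0' (not_le.2 h)
      · exact absurd (hm0 m' ⟨h3, (lt_of_lt_of_le h4 h0').le⟩) (not_le.2 h4)
    rw [(hμ m0 v).1 hcm0] at h1
    exact absurd (hm0 m ⟨h2.le, hm⟩) (not_le.2 h1)
  · intro ν hν
    -- `Rν` is closed under `F`, hence contains all of `R`. No pair matched by `ν` lies in `Rν`, so
    -- the `ν`-wife of a man never rejects him.
    let Rν : Set (Fin M × Fin W) := {x | (women x.2).Prefers (ν.husband x.2) (some x.1)}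
    have hsub : R ⊆ Rν := by
      apply F.lfp_le
      rintro ⟨m, v⟩ (h | ⟨m', h1, h2⟩)
      · exact lt_of_le_of_lt (not_lt.1 (hν.2.1 v)) h
      · refine lt_of_le_of_lt ?_ h2
        have hle : (men m').pos (some v) ≤ (men m').pos (ν.wife m') := by
          refine h1.trans (hmin Rν m' _ ?_)
          intro v' hv' hlt
          have := (ν.consistent _ _).1 hv'
          simp only [Rν, Set.mem_ofPred_eq, this] at hlt
          exact lt_irrefl _ hlt
        rcases hle.eq_or_lt with h | h
        · rw [(ν.consistent _ _).1 ((men m').pos_injective h).symm]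
        · by_contra hcon
          exact hν.2.2 m' v ⟨not_le.1 hcon, h⟩
    intro m
    refine hmin R m _ ?_
    intro v' hv' hin
    have hlt := hsub hin
    simp only [Rν, Set.mem_ofPred_eq, (ν.consistent _ _).1 hv'] at hlt
    exact lt_irrefl _ hlt

/-- If `v` preferred her `μ`-husband to her `ν`-assignment, the two would block `ν`, because he
weakly prefers `μ` and cannot be matched to her in `ν`. -/
theorem Matching.IsManOptimal.husband_le {M W : ℕ} {μ ν : Matching M W}
    {men : Fin M → PrefList W} {women : Fin W → PrefList M} (hμ : μ.IsManOptimal men women)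
    (hν : ν.IsStable men women) (v : Fin W) :
    (women v).pos (ν.husband v) ≤ (women v).pos (μ.husband v) := by
  cases h : μ.husband v with
  | none => exact not_lt.1 (hν.2.1 v)
  | some m =>
    by_contra hcon
    have hw := (μ.consistent m v).2 h
    have hle := hμ ν hν m
    rw [hw] at hle
    rcases hle.eq_or_lt with he | hlt
    · rw [(ν.consistent _ _).1 ((men m).pos_injective he).symm] at hcon
      exact hcon le_rfl
    · exact hν.2.2 m v ⟨not_le.1 hcon, hlt⟩

/-- If every wife of a man of `S` in the man-optimal matching prefers him to all men outside `S`,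
then the men of `S` have the same set of wives in all stable matchings. -/
theorem Matching.IsManOptimal.husband_notMem_of_separator {M W : ℕ} {μ ν : Matching M W}
    {men : Fin M → PrefList W} {women : Fin W → PrefList M} (hμ : μ.IsManOptimal men women)
    (hsμ : μ.IsStable men women)
    (hν : ν.IsStable men women) (S : Set (Fin M))
    (hS : ∀ m ∈ S, ∀ v, μ.wife m = some v → ∀ m' ∉ S, (women v).Prefers (some m) (some m'))
    {w : Fin W} (hw : ∀ m ∈ S, μ.wife m ≠ some w) : ∀ m ∈ S, ν.husband w ≠ some m := by
  classical
  let S' : Set (Fin M) := {m ∈ S | ∃ v, μ.wife m = some v}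
  -- Send a man to the `ν`-husband of his `μ`-wife. She does no worse in `ν`, so `hS` keeps the
  -- image in `S`. This self-map of the finite set `S'` is injective, hence surjective, so the
  -- `ν`-wives of the men of `S'` are all `μ`-wives of such men.
  have key : ∀ m : S', ∃ m' : S', ∃ v, μ.wife m = some v ∧ ν.husband v = some m' := by
    rintro ⟨m, hm, v, hv⟩
    have hle := hμ.husband_le hν v
    have hh := (μ.consistent _ _).1 hv
    cases hn : ν.husband v with
    | none =>
      rw [hn, hh] at hle
      have h2 := hsμ.2.1 v
      rw [hh] at h2
      have := (women v).pos_injective (le_antisymm hle (not_lt.1 h2))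
      simp at this
    | some m' =>
      have hm' : m' ∈ S := by
        by_contra hcon
        have := hS m hm v hv m' hcon
        rw [hn, hh] at hle
        exact absurd hle (not_le.2 this)
      have hwife := (ν.consistent _ _).2 hn
      refine ⟨⟨m', hm', ?_⟩, v, hv, hn⟩
      cases hwm : μ.wife m' with
      | some v' => exact ⟨v', rfl⟩
      | none =>
        have h1 := hμ ν hν m'
        rw [hwm, hwife] at h1
        have h2 := hν.1 m'
        rw [hwife] at h2
        have := (men m').pos_injective (le_antisymm h1 (not_lt.1 h2))
        simp at this
  choose f g hg hf using key
  have hinj : Function.Injective f := by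
    intro a b hab
    have h1 := (ν.consistent _ _).2 (hf a)
    have h2 := (ν.consistent _ _).2 (hf b)
    rw [hab, h2] at h1
    have h3 : g b = g a := by simpa using h1
    have h4 := (μ.consistent _ _).1 (hg a)
    have h5 := (μ.consistent _ _).1 (hg b)
    rw [h3, h4] at h5
    exact Subtype.ext (by simpa using h5)
  intro m hm hwm
  have hwife := (ν.consistent _ _).2 hwm
  have hmS' : m ∈ S' := by
    refine ⟨hm, ?_⟩
    cases hwm : μ.wife m with
    | some v' => exact ⟨v', rfl⟩
    | none =>
      have h1 := hμ ν hν m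
      rw [hwm, hwife] at h1
      have h2 := hν.1 m
      rw [hwife] at h2
      have := (men m).pos_injective (le_antisymm h1 (not_lt.1 h2))
      simp at this
  obtain ⟨a, ha⟩ := (Finite.injective_iff_surjective.1 hinj) ⟨m, hmS'⟩
  have h1 := (ν.consistent _ _).2 (hf a)
  rw [ha] at h1
  simp only at h1
  rw [hwife] at h1
  have h2 : w = g a := by simpa using h1
  exact hw a a.2.1 (h2 ▸ hg a)

/-- The set of all men is trivially a separator. -/
theorem Matching.IsManOptimal.exists_husband {M W : ℕ} {μ : Matching M W}
    {men : Fin M → PrefList W} {women : Fin W → PrefList M} (hμ : μ.IsManOptimal men women)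
    (hsμ : μ.IsStable men women) {w : Fin W} (hw : (stablePartners men women w).Nonempty) :
    ∃ m, μ.husband w = some m := by
  obtain ⟨m, ν, hν, hm⟩ := hw
  by_contra hcon
  push Not at hcon
  exact hμ.husband_notMem_of_separator hsμ hν Set.univ (by simp)
    (fun m _ h => hcon m ((μ.consistent _ _).1 h)) m trivial hm

/-! ### The information that determines the man-optimal matching. -/

/-- The two preference lists order the men of `T` in the same way. -/
def PrefList.Agree {n : ℕ} (T : Set (Fin n)) (p q : PrefList n) : Prop :=
  ∀ a ∈ T, ∀ b ∈ T, (p.Prefers (some a) (some b) ↔ q.Prefers (some a) (some b))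

/-- The men who weakly prefer `v` to their assignment. -/
def Matching.proposers {M W : ℕ} (μ : Matching M W) (men : Fin M → PrefList W) (v : Fin W) :
    Set (Fin M) :=
  {m | (men m).pos (some v) ≤ (men m).pos (μ.wife m)}

/-- A potential blocking man of `v` is compared only with her husband, and both weakly prefer `v` to
their assignments. -/
theorem Matching.IsStable.of_agree {M W : ℕ} {μ : Matching M W}
    {men : Fin M → PrefList W} {p q : Fin W → PrefList M} {A : Fin W → Set (Fin M)}
    (hp : ∀ v m, (p v).Accepts m ↔ m ∈ A v) (hq : ∀ v m, (q v).Accepts m ↔ m ∈ A v)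
    (hμ : μ.IsStable men p)
    (h : ∀ v, PrefList.Agree (μ.proposers men v ∩ A v) (p v) (q v)) : μ.IsStable men q := by
  have hacc : ∀ m v, μ.husband v = some m → m ∈ A v := by
    intro m v hm
    rw [← hp]
    have h1 := hμ.2.1 v
    rw [hm] at h1
    exact lt_of_le_of_ne (not_lt.1 h1) fun h => by simpa using (p v).pos_injective h
  have hacc' : ∀ v, ¬ (q v).Prefers none (μ.husband v) := by
    intro v hcon
    cases hm : μ.husband v with
    | none => rw [hm] at hcon; exact lt_irrefl _ hcon
    | some m =>
      rw [hm] at hcon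
      exact lt_asymm hcon ((hq v m).2 (hacc m v hm))
  refine ⟨hμ.1, hacc', ?_⟩
  rintro m v ⟨h1, h2⟩
  have hmA : m ∈ A v := by
    rw [← hq]
    exact lt_of_lt_of_le h1 (not_lt.1 (hacc' v))
  cases hm : μ.husband v with
  | none =>
    refine hμ.2.2 m v ⟨?_, h2⟩
    rw [hm]
    exact (hp v m).2 hmA
  | some m' =>
    refine hμ.2.2 m v ⟨?_, h2⟩
    rw [hm] at h1 ⊢
    refine (h v m ⟨h2.le, hmA⟩ m' ⟨?_, hacc m' v hm⟩).2 h1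
    change (men m').pos (some v) ≤ (men m').pos (μ.wife m')
    rw [(μ.consistent _ _).2 hm]

theorem Matching.IsManOptimal.eq {M W : ℕ} {μ ν : Matching M W}
    {men : Fin M → PrefList W} {women : Fin W → PrefList M} (hμ : μ.IsManOptimal men women)
    (hν : ν.IsManOptimal men women) (hsμ : μ.IsStable men women) (hsν : ν.IsStable men women) :
    μ = ν := by
  have h1 : μ.wife = ν.wife := funext fun m =>
    (men m).pos_injective (le_antisymm (hμ ν hsν m) (hν μ hsμ m))
  have h2 : μ.husband = ν.husband := funext fun v => Option.ext fun m => by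
    rw [← μ.consistent, h1, ν.consistent]
  cases μ; cases ν; simp_all

/-- The man-optimal `ν` for `q` is at least as good for the men as `μ`, so its proposers are among
those of `μ`. The same agreement therefore makes `ν` stable for `p`, where `μ` is optimal. -/
theorem Matching.IsManOptimal.of_agree {M W : ℕ} {μ : Matching M W}
    {men : Fin M → PrefList W} {p q : Fin W → PrefList M} {A : Fin W → Set (Fin M)}
    (hp : ∀ v m, (p v).Accepts m ↔ m ∈ A v) (hq : ∀ v m, (q v).Accepts m ↔ m ∈ A v)
    (hμ : μ.IsStable men p) (hopt : μ.IsManOptimal men p)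
    (h : ∀ v, PrefList.Agree (μ.proposers men v ∩ A v) (p v) (q v)) :
    μ.IsManOptimal men q := by
  obtain ⟨ν, hν, hνopt⟩ := exists_isStable_isManOptimal men q
  have hμq := hμ.of_agree hp hq h
  have hle := hνopt μ hμq
  have hνp : ν.IsStable men p := hν.of_agree hq hp fun v a ha b hb =>
    (h v a ⟨le_trans ha.1 (hle a), ha.2⟩ b ⟨le_trans hb.1 (hle b), hb.2⟩).symm
  intro ν' hν' m
  exact (hopt ν hνp m).trans (hνopt ν' hν' m)

end StableMarriage

namespace StableMarriage

/-! ### Regular distributions and odds. -/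

section Regular

variable {n : ℕ}

theorem PrefList.Agree.refl (T : Set (Fin n)) (p : PrefList n) : p.Agree T p :=
  fun _ _ _ _ => Iff.rfl

theorem PrefList.Agree.mono {T T' : Set (Fin n)} {p q : PrefList n} (h : p.Agree T' q)
    (hT : T ⊆ T') : p.Agree T q :=
  fun a ha b hb => h a (hT ha) b (hT hb)

theorem mem_rankedInOrder_iff_pairwise {l : List (Fin n)} {p : PrefList n} :
    p ∈ rankedInOrder l ↔ l.Pairwise fun a b => p.Prefers (some a) (some b) := by
  have : IsTrans (Fin n) fun a b => p.Prefers (some a) (some b) :=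
    ⟨fun _ _ _ h h' => lt_trans h h'⟩
  exact List.isChain_iff_pairwise

theorem exists_mem_rankedInOrder (p : PrefList n) (T : Finset (Fin n)) :
    ∃ l : List (Fin n), (∀ a, a ∈ l ↔ a ∈ T) ∧ p ∈ rankedInOrder l := by
  induction T using Finset.induction_on_min_value (fun a => p.pos (some a)) with
  | empty => exact ⟨[], by simp, by simp [rankedInOrder]⟩
  | insert a s ha hmin ih =>
    obtain ⟨l, hl, hp⟩ := ih
    refine ⟨a :: l, by simp [hl], ?_⟩
    rw [mem_rankedInOrder_iff_pairwise] at hp ⊢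
    refine List.pairwise_cons.2 ⟨fun b hb => ?_, hp⟩
    have hb' := (hl b).1 hb
    refine lt_of_le_of_ne (hmin b hb') fun h => ?_
    have : a = b := by simpa using p.pos_injective h
    exact ha (this ▸ hb')

/-- Identifies the classes of lists with a given order on `T` with the chain events that occur in
`IsRegular`. -/
theorem agree_iff_mem_rankedInOrder {p q : PrefList n} {T : Set (Fin n)} {l : List (Fin n)}
    (hl : ∀ a, a ∈ l ↔ a ∈ T) (hp : p ∈ rankedInOrder l) :
    p.Agree T q ↔ q ∈ rankedInOrder l := by
  rw [mem_rankedInOrder_iff_pairwise] at hp ⊢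
  constructor
  · intro h
    exact hp.imp_of_mem fun {a b} ha hb hab => (h a ((hl a).1 ha) b ((hl b).1 hb)).1 hab
  · intro hq
    have key : ∀ (r r' : PrefList n), (l.Pairwise fun a b => r.Prefers (some a) (some b)) →
        (l.Pairwise fun a b => r'.Prefers (some a) (some b)) → ∀ a ∈ T, ∀ b ∈ T,
        r.Prefers (some a) (some b) → r'.Prefers (some a) (some b) := by
      intro r r' hr hr' a ha b hb hab
      have hne : a ≠ b := by rintro rfl; exact lt_irrefl _ hab
      have hor : l.Pairwise fun a b => (r.Prefers (some a) (some b) ∧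
          r'.Prefers (some a) (some b)) := hr.and hr'
      have := List.Pairwise.forall_of_forall_of_flip (R := fun a b =>
        r.Prefers (some a) (some b) → r'.Prefers (some a) (some b))
        (l := l) (fun x _ hx => absurd hx (lt_irrefl _)) (hor.imp fun h _ => h.2)
        (hor.imp fun h h' => absurd h' (lt_asymm h.1))
      exact this ((hl a).2 ha) ((hl b).2 hb) hab
    exact fun a ha b hb => ⟨key p q hp hq a ha b hb, key q p hq hp a ha b hb⟩

/-- Regularity, conditionally on an event that concerns the order of a set of men and says that
a given one is preferred to all others. -/
theorem IsRegular.measure_rankedBefore_inter_le {D : Measure (PrefList n)}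
    [IsProbabilityMeasure D] {A : Set (Fin n)} (hD : IsRegular D A) {T : Set (Fin n)}
    (hT : T ⊆ A) {a₁ a₂ : Fin n} (h₁ : a₁ ∈ A) (h₂ : a₂ ∈ T) {E : Set (PrefList n)}
    (hE : ∀ p ∈ E, ∀ q, p.Agree T q → q ∈ E)
    (hbest : ∀ p ∈ E, ∀ b ∈ T, b ≠ a₂ → p.Prefers (some a₂) (some b)) :
    D (rankedBefore a₁ a₂ ∩ E) ≤ D (rankedBefore a₁ a₂) * D E := by
  classical
  -- `E` is a union of classes of lists with a common order on `T`. Each class is a chain event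
  -- whose chain starts with `a₂` by `hbest`, so regularity applies class by class.
  let key : PrefList n → Set (PrefList n) := fun p => {q | p.Agree T q}
  have hsplit : ∀ B : Set (PrefList n), D B = ∑ k, D (B ∩ key ⁻¹' {k}) := fun B => by
    have h := sum_measure_preimage_singleton (μ := D.restrict B) (f := key) Finset.univ
      (fun _ _ => MeasurableSet.of_discrete)
    simp only [Finset.coe_univ, Set.preimage_univ,
      Measure.restrict_apply MeasurableSet.of_discrete, Set.univ_inter] at h
    rw [← h]
    exact Finset.sum_congr rfl fun k _ => by rw [Set.inter_comm]
  rw [hsplit (rankedBefore a₁ a₂ ∩ E), hsplit E, Finset.mul_sum]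
  refine Finset.sum_le_sum fun k _ => ?_
  rw [Set.inter_assoc]
  by_cases hne : (E ∩ key ⁻¹' {k}).Nonempty
  · obtain ⟨p, hpE, hpk⟩ := hne
    obtain ⟨l, hl, hpl⟩ := exists_mem_rankedInOrder p T.toFinite.toFinset
    simp only [Set.Finite.mem_toFinset] at hl
    have hfib : E ∩ key ⁻¹' {k} = rankedInOrder l := by
      ext q
      rw [← agree_iff_mem_rankedInOrder hl hpl]
      constructor
      · rintro ⟨-, hq⟩
        have : q ∈ key p := by rw [hpk, ← hq]; exact PrefList.Agree.refl T q
        exact this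
      · intro hq
        refine ⟨hE p hpE q hq, ?_⟩
        change key q = k
        rw [← hpk]
        ext r
        exact ⟨fun hr a ha b hb => (hq a ha b hb).trans (hr a ha b hb),
          fun hr a ha b hb => (hq a ha b hb).symm.trans (hr a ha b hb)⟩
    have hlT : ∃ l', l = a₂ :: l' := by
      cases l with
      | nil => simpa using (hl a₂).2 h₂
      | cons b l' =>
        by_cases hb : b = a₂
        · exact ⟨l', by rw [hb]⟩
        · exfalso
          have h3 := (hl a₂).2 h₂
          rw [List.mem_cons] at h3
          rw [mem_rankedInOrder_iff_pairwise, List.pairwise_cons] at hpl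
          have h4 := hpl.1 a₂ (h3.resolve_left fun h => hb h.symm)
          exact lt_asymm h4 (hbest p hpE b ((hl b).1 (by simp)) hb)
    obtain ⟨l', rfl⟩ := hlT
    rw [hfib]
    have h3 := hD a₁ a₂ l' h₁ (hT h₂) (fun a ha => hT ((hl a).1 (by simp [ha])))
    rw [cond_apply MeasurableSet.of_discrete] at h3
    rcases eq_or_ne (D (rankedInOrder (a₂ :: l'))) 0 with h0 | h0
    · rw [measure_mono_null Set.inter_subset_right h0]
      exact zero_le
    · calc D (rankedBefore a₁ a₂ ∩ rankedInOrder (a₂ :: l'))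
          = ((D (rankedInOrder (a₂ :: l')))⁻¹ *
              D (rankedInOrder (a₂ :: l') ∩ rankedBefore a₁ a₂)) *
              D (rankedInOrder (a₂ :: l')) := by
            rw [mul_comm, ← mul_assoc, ENNReal.mul_inv_cancel h0 (measure_ne_top _ _), one_mul,
              Set.inter_comm]
        _ ≤ _ := by gcongr
  · rw [Set.not_nonempty_iff_eq_empty] at hne
    simp [hne]

theorem measure_rankedBefore_add {D : Measure (PrefList n)} [IsProbabilityMeasure D]
    {a b : Fin n} (hab : a ≠ b) : D (rankedBefore a b) + D (rankedBefore b a) = 1 := by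
  have hc : rankedBefore b a = (rankedBefore a b)ᶜ := by
    ext p
    simp only [rankedBefore, PrefList.Prefers, Set.mem_compl_iff, Set.mem_ofPred_eq, not_lt]
    refine ⟨le_of_lt, fun h => lt_of_le_of_ne h fun h' => hab ?_⟩
    simpa using (p.pos_injective h').symm
  rw [hc, measure_add_measure_compl MeasurableSet.of_discrete, measure_univ]

end Regular

section Odds

variable {M W : ℕ} {D : Fin W → Measure (PrefList M)} {A : Fin W → Set (Fin M)}

theorem div_le_maxOdds {w : Fin W} {i j : Fin M} (hij : i < j) (hi : i ∈ A w)
    (hj : j ∈ A w) :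
    D w (rankedBefore j i) / D w (rankedBefore i j) ≤ maxOdds D A ((j : ℕ) - i) := by
  unfold maxOdds
  exact le_iSup_of_le w <| le_iSup_of_le i <| le_iSup_of_le j <|
    le_iSup_of_le (by have : (i : ℕ) < j := hij; omega) <| le_iSup_of_le hi <|
    le_iSup_of_le hj le_rfl

variable [∀ w, IsProbabilityMeasure (D w)]

theorem measure_rankedBefore_le_maxOdds {w : Fin W} {i j : Fin M} (hij : i < j) (hi : i ∈ A w)
    (hj : j ∈ A w) : D w (rankedBefore j i) ≤ maxOdds D A ((j : ℕ) - i) := by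
  refine le_trans ?_ (div_le_maxOdds hij hi hj)
  calc D w (rankedBefore j i) = D w (rankedBefore j i) / 1 := by simp
    _ ≤ _ := ENNReal.div_le_div_left prob_le_one _

/-- The two orders have total probability one, and finite odds exclude a vanishing denominator. -/
theorem one_le_one_add_maxOdds_mul {w : Fin W} {i j : Fin M} (hij : i < j) (hi : i ∈ A w)
    (hj : j ∈ A w) (hfin : maxOdds D A ((j : ℕ) - i) ≠ ∞) :
    1 ≤ (1 + maxOdds D A ((j : ℕ) - i)) * D w (rankedBefore i j) := by
  have hadd := measure_rankedBefore_add (D := D w) hij.ne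
  have hdiv := div_le_maxOdds (D := D) hij hi hj
  have h0 : D w (rankedBefore i j) ≠ 0 := by
    intro h0
    rw [h0, zero_add] at hadd
    rw [h0, hadd, ENNReal.div_zero one_ne_zero] at hdiv
    exact hfin (top_le_iff.1 hdiv)
  rw [ENNReal.div_le_iff h0 (measure_ne_top _ _)] at hdiv
  rw [add_mul, one_mul, ← hadd]
  gcongr

/-- If, on the event `E` about the order of the men of `T`, the man `i` is preferred to all other
men of `T`, then `E` loses at most a factor `1 + u` when `i` is required to be preferred also
to `j`. -/
theorem measure_le_one_add_maxOdds_mul {w : Fin W} (hD : IsRegular (D w) (A w)) {i j : Fin M}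
    (hij : i < j) (hj : j ∈ A w) (hfin : maxOdds D A ((j : ℕ) - i) ≠ ∞) {T : Set (Fin M)}
    (hT : T ⊆ A w) (hi : i ∈ T) {E : Set (PrefList M)}
    (hE : ∀ p ∈ E, ∀ q, p.Agree T q → q ∈ E)
    (hbest : ∀ p ∈ E, ∀ b ∈ T, b ≠ i → p.Prefers (some i) (some b)) :
    D w E ≤ (1 + maxOdds D A ((j : ℕ) - i)) * D w (rankedBefore i j ∩ E) := by
  have hreg := hD.measure_rankedBefore_inter_le hT hj hi hE hbest
  have hadd := measure_rankedBefore_add (D := D w) hij.ne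
  have hone := one_le_one_add_maxOdds_mul hij (hT hi) hj hfin
  have hsplit : D w (rankedBefore i j ∩ E) + D w (rankedBefore j i ∩ E) = D w E := by
    have hc : rankedBefore j i ∩ E = E \ rankedBefore i j := by
      ext p
      simp only [rankedBefore, PrefList.Prefers, Set.mem_inter_iff, Set.mem_sdiff,
        Set.mem_ofPred_eq, not_lt]
      refine ⟨fun h => ⟨h.2, h.1.le⟩, fun h => ⟨lt_of_le_of_ne h.2 fun h' => hij.ne ?_, h.1⟩⟩
      simpa using (p.pos_injective h').symm
    rw [hc, Set.inter_comm, measure_inter_add_sdiff _ MeasurableSet.of_discrete]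
  -- Regularity says that `E` makes `j` before `i` no more likely; by complement it makes `i` before
  -- `j` no less likely.
  have hG : D w (rankedBefore i j) * D w E ≤ D w (rankedBefore i j ∩ E) := by
    have h1 : D w (rankedBefore i j) * D w E + D w (rankedBefore j i) * D w E
        ≤ D w (rankedBefore i j ∩ E) + D w (rankedBefore j i) * D w E := by
      rw [← add_mul, hadd, one_mul, ← hsplit]
      gcongr
      rwa [hsplit]
    exact (ENNReal.add_le_add_iff_right
      (ENNReal.mul_ne_top (measure_ne_top _ _) (measure_ne_top _ _))).1 h1
  calc D w E ≤ ((1 + maxOdds D A ((j : ℕ) - i)) * D w (rankedBefore i j)) * D w E :=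
        le_mul_of_one_le_left' hone
    _ ≤ _ := by rw [mul_assoc]; gcongr

end Odds

end StableMarriage

namespace StableMarriage

/-! ### Independence of disjoint sets of coordinates. -/

section Independence

theorem measure_pi_eval {ι X : Type*} [Fintype ι] [MeasurableSpace X] [DiscreteMeasurableSpace X]
    (ν : ι → Measure X) [∀ i, IsProbabilityMeasure (ν i)] (v : ι) (B : Set X) :
    Measure.pi ν {q | q v ∈ B} = ν v B :=
  (measurePreserving_eval ν v).measure_preimage MeasurableSet.of_discrete.nullMeasurableSet

theorem dependsOn_indicator {ι X : Type*} {E : Set (ι → X)} {S : Set ι} (hE : DependsOn (· ∈ E) S)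
    {f : (ι → X) → ℝ≥0∞} (hf : DependsOn f S) : DependsOn (E.indicator f) S := by
  classical
  intro x y h
  have h1 : x ∈ E ↔ y ∈ E := iff_of_eq (hE h)
  simp only [Set.indicator_apply, h1, hf h]

variable {ι X : Type*} [Fintype ι] [Countable X] [MeasurableSpace X] [DiscreteMeasurableSpace X]
  (ν : ι → Measure X) [∀ i, IsProbabilityMeasure (ν i)]

theorem lintegral_mul_of_dependsOn {S T : Set ι} (hST : Disjoint S T)
    {f g : (ι → X) → ℝ≥0∞} (hf : DependsOn f S) (hg : DependsOn g T) :
    ∫⁻ q, f q * g q ∂(Measure.pi ν) = (∫⁻ q, f q ∂(Measure.pi ν)) * ∫⁻ q, g q ∂(Measure.pi ν) := by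
  classical
  obtain ⟨f', hf'⟩ := dependsOn_iff_exists_comp.1 (hf.mono (t := (S.toFinset : Set ι)) (by simp))
  obtain ⟨g', hg'⟩ := dependsOn_iff_exists_comp.1 (hg.mono (t := (T.toFinset : Set ι)) (by simp))
  have h := iIndepFun_pi (μ := ν) (X := fun _ x => x) (fun i => aemeasurable_id)
  have h2 := h.indepFun_finset S.toFinset T.toFinset (by simpa using hST)
    (fun i => measurable_pi_apply i)
  refine lintegral_mul_eq_lintegral_mul_lintegral_of_indepFun''
    (Measurable.of_discrete).aemeasurable (Measurable.of_discrete).aemeasurable ?_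
  rw [hf', hg']
  exact h2.comp (φ := f') (ψ := g') Measurable.of_discrete Measurable.of_discrete

theorem measure_inter_of_dependsOn {S T : Set ι} (hST : Disjoint S T)
    {E F : Set (ι → X)} (hE : DependsOn (· ∈ E) S) (hF : DependsOn (· ∈ F) T) :
    Measure.pi ν (E ∩ F) = Measure.pi ν E * Measure.pi ν F := by
  have h := lintegral_mul_of_dependsOn ν hST
    (dependsOn_indicator hE (f := 1) (fun _ _ _ => rfl))
    (dependsOn_indicator hF (f := 1) (fun _ _ _ => rfl))
  rw [lintegral_indicator_one MeasurableSet.of_discrete,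
    lintegral_indicator_one MeasurableSet.of_discrete] at h
  rw [← h, ← lintegral_indicator_one MeasurableSet.of_discrete, Set.inter_indicator_one]
  rfl

end Independence

/-! ### Expected distance to the last cut, for independent coordinates with labels. -/

section Cuts

variable {ι X : Type*} (ℓ : ι → ℕ) (L : ι → ℕ → Set X)

/-- The coordinates with label less than `s` are all in their set of level `c`. -/
def prefixEvent (s c : ℕ) : Set (ι → X) := {q | ∀ v, ℓ v < s → q v ∈ L v c}

open Classical in
/-- The last `t ≤ s` such that the coordinates with label less than `t` are all in their set of
level `t`. -/
noncomputable def lastCut (s : ℕ) (q : ι → X) : ℕ :=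
  Nat.findGreatest (fun t => q ∈ prefixEvent ℓ L t t) s

theorem lastCut_le (s : ℕ) (q : ι → X) : lastCut ℓ L s q ≤ s := by
  classical exact Nat.findGreatest_le s

/-- The level `0` is vacuously a cut, so the default value of the search is one too. -/
theorem mem_prefixEvent_lastCut (s : ℕ) (q : ι → X) :
    q ∈ prefixEvent ℓ L (lastCut ℓ L s q) (lastCut ℓ L s q) := by
  classical
  exact Nat.findGreatest_spec (P := fun t => q ∈ prefixEvent ℓ L t t) (Nat.zero_le s)
    (fun v hv => absurd hv (Nat.not_lt_zero _))

theorem lastCut_eq {s : ℕ} {q : ι → X} (h : q ∈ prefixEvent ℓ L s s) : lastCut ℓ L s q = s := by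
  classical
  exact le_antisymm (lastCut_le ℓ L s q) (Nat.le_findGreatest le_rfl h)

theorem lastCut_mono {s t : ℕ} (h : s ≤ t) (q : ι → X) : lastCut ℓ L s q ≤ lastCut ℓ L t q := by
  classical
  exact Nat.findGreatest_mono_right _ h

theorem dependsOn_prefixEvent (s c : ℕ) : DependsOn (· ∈ prefixEvent ℓ L s c) {v | ℓ v < s} := by
  intro x y h
  refine propext (forall_congr' fun v => forall_congr' fun hv => ?_)
  rw [h v hv]

theorem dependsOn_lastCut (s : ℕ) : DependsOn (lastCut ℓ L s) {v | ℓ v < s} := by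
  classical
  have key : ∀ x y : ι → X, (∀ v ∈ {v | ℓ v < s}, x v = y v) →
      lastCut ℓ L s x ≤ lastCut ℓ L s y := by
    intro x y h
    refine Nat.le_findGreatest (lastCut_le ℓ L s x) ?_
    refine ((iff_of_eq (dependsOn_prefixEvent ℓ L _ _ ?_)).1 (mem_prefixEvent_lastCut ℓ L s x))
    exact fun v hv => h v (lt_of_lt_of_le hv (lastCut_le ℓ L s x))
  exact fun x y h => le_antisymm (key x y h) (key y x fun v hv => (h v hv).symm)

theorem measure_prefixEvent [Fintype ι] [MeasurableSpace X] (ν : ι → Measure X)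
    [∀ i, IsProbabilityMeasure (ν i)] (s c : ℕ) :
    Measure.pi ν (prefixEvent ℓ L s c) = ∏ v with ℓ v < s, ν v (L v c) := by
  classical
  have : prefixEvent ℓ L s c = Set.univ.pi fun v => if ℓ v < s then L v c else Set.univ := by
    ext q
    simp only [prefixEvent, Set.mem_pi, Set.mem_univ, true_imp_iff, Set.mem_ofPred_eq]
    refine forall_congr' fun v => ?_
    split_ifs with h <;> simp [h]
  rw [this, Measure.pi_pi, Finset.prod_filter]
  refine Finset.prod_congr rfl fun v _ => ?_
  split_ifs <;> simp

theorem measure_prefixEvent_le [Fintype ι] [MeasurableSpace X] (ν : ι → Measure X)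
    [∀ i, IsProbabilityMeasure (ν i)] {s c : ℕ} {a : ι → ℝ≥0∞} {Q : ℝ≥0∞}
    (h : ∀ v, ℓ v < s → ν v (L v c) ≤ a v * ν v (L v s)) (hQ : ∏ v with ℓ v < s, a v ≤ Q) :
    Measure.pi ν (prefixEvent ℓ L s c) ≤ Q * Measure.pi ν (prefixEvent ℓ L s s) := by
  rw [measure_prefixEvent, measure_prefixEvent]
  calc _ ≤ ∏ v with ℓ v < s, a v * ν v (L v s) :=
        Finset.prod_le_prod' fun v hv => h v (Finset.mem_filter.1 hv).2
    _ = (∏ v with ℓ v < s, a v) * ∏ v with ℓ v < s, ν v (L v s) := Finset.prod_mul_distrib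
    _ ≤ _ := by gcongr

variable [Fintype ι] [Countable X] [MeasurableSpace X] [DiscreteMeasurableSpace X]
  (ν : ι → Measure X) [∀ i, IsProbabilityMeasure (ν i)]

/-- The conditions on the other coordinates, `F`, are independent of coordinate `v` and factor out.
-/
theorem measure_prefixEvent_inter_notMem_le {s c : ℕ} {v : ι} (hv : ℓ v < s) {b : ℝ≥0∞}
    (h : ν v (L v c \ L v s) ≤ b * ν v (L v c)) :
    Measure.pi ν (prefixEvent ℓ L s c ∩ {q | q v ∉ L v s}) ≤
      b * Measure.pi ν (prefixEvent ℓ L s c) := by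
  let F : Set (ι → X) := {q | ∀ v', v' ≠ v → ℓ v' < s → q v' ∈ L v' c}
  have hF : DependsOn (· ∈ F) {v}ᶜ := by
    intro x y h
    refine propext (forall_congr' fun v' => forall_congr' fun hv' => ?_)
    rw [h v' hv']
  have hB : ∀ B : Set X, DependsOn (· ∈ {q : ι → X | q v ∈ B}) {v} := by
    intro B x y h
    simp only [Set.mem_ofPred_eq, h v rfl]
  have h1 : prefixEvent ℓ L s c = {q | q v ∈ L v c} ∩ F := by
    ext q
    refine ⟨fun hq => ⟨hq v hv, fun v' _ => hq v'⟩, fun hq v' hv' => ?_⟩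
    by_cases hvv : v' = v
    · subst hvv; exact hq.1
    · exact hq.2 v' hvv hv'
  have h2 : prefixEvent ℓ L s c ∩ {q | q v ∉ L v s} = {q | q v ∈ L v c \ L v s} ∩ F := by
    rw [h1]
    ext q
    simp only [Set.mem_inter_iff, Set.mem_ofPred_eq, Set.mem_sdiff]
    tauto
  have hd : Disjoint ({v} : Set ι) {v}ᶜ := disjoint_compl_right
  rw [h2, h1, measure_inter_of_dependsOn ν hd (hB _) hF,
    measure_inter_of_dependsOn ν hd (hB _) hF, measure_pi_eval, measure_pi_eval, ← mul_assoc]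
  gcongr

/-- If `s` is not a cut, let `i` be the least label of a coordinate violating level `s`. The
coordinates below `i` then satisfy level `s`, so the induction hypothesis applies to `i` with `s` in
the role of `c`; this is why the statement has a second level `c`. The bound does not grow along the
recursion, because the cost of the jump from `s` to `i` is charged to the event that `s` is a cut,
where the distance is zero. -/
theorem lintegral_sub_lastCut_le (hL : ∀ v, Monotone (L v)) {N : ℕ} {Q K : ℝ≥0∞}
    (a b : ι → ℕ → ℕ → ℝ≥0∞)
    (ha : ∀ v s c, ℓ v < s → s ≤ c → c ≤ N → ν v (L v c) ≤ a v s c * ν v (L v s))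
    (hb : ∀ v s c, ℓ v < s → s ≤ c → c ≤ N → ν v (L v c \ L v s) ≤ b v s c * ν v (L v c))
    (hQ : ∀ s c, s ≤ c → c ≤ N → ∏ v with ℓ v < s, a v s c ≤ Q)
    (hK : ∀ s c, s ≤ c → c ≤ N → ∑ v with ℓ v < s, ((s - ℓ v : ℕ) : ℝ≥0∞) * b v s c ≤ K)
    (s : ℕ) : ∀ c, s ≤ c → c ≤ N →
    ∫⁻ q in prefixEvent ℓ L s c, ((s - lastCut ℓ L s q : ℕ) : ℝ≥0∞) ∂(Measure.pi ν) ≤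
      Q * K * Measure.pi ν (prefixEvent ℓ L s c) := by
  classical
  induction s using Nat.strong_induction_on with
  | _ s ih =>
  intro c hsc hcN
  let R : ℕ → Set (ι → X) := fun i =>
    {q | (∃ v, ℓ v = i ∧ q v ∉ L v s) ∧ ∀ v, i ≤ ℓ v → ℓ v < s → q v ∈ L v c}
  -- `J i`: the least violating label is `i`. It splits into a condition on labels below `i` and the
  -- condition `R i` on labels at least `i`, which are independent.
  let J : ℕ → Set (ι → X) := fun i => prefixEvent ℓ L i s ∩ R i
  have hR : ∀ i, DependsOn (· ∈ R i) {v | i ≤ ℓ v} := by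
    intro i x y h
    refine propext (and_congr (exists_congr fun v => and_congr_right fun hv => ?_)
      (forall_congr' fun v => forall_congr' fun hv => ?_))
    · rw [h v hv.ge]
    · rw [h v hv]
  have hdisj : ∀ i, Disjoint {v | ℓ v < i} {v | i ≤ ℓ v} := fun i =>
    Set.disjoint_left.2 fun v hv hv' =>
      absurd (show ℓ v < i from hv) (not_lt.2 hv')
  have hJE : ∀ i, J i ⊆ prefixEvent ℓ L s c := by
    rintro i q ⟨h1, -, h2⟩ v hv
    rcases lt_or_ge (ℓ v) i with hi | hi
    · exact hL v hsc (h1 v hi)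
    · exact h2 v hi hv
  have hJs : ∀ i < s, Disjoint (J i) (prefixEvent ℓ L s s) := by
    intro i hi
    refine Set.disjoint_left.2 ?_
    rintro q ⟨-, ⟨v, hv, hvn⟩, -⟩ h2
    exact hvn (h2 v (hv ▸ hi))
  have hJdisj : ∀ i j, i < j → Disjoint (J i) (J j) := by
    intro i j hij
    refine Set.disjoint_left.2 ?_
    rintro q ⟨-, ⟨v, hv, hvn⟩, -⟩ ⟨h2, -⟩
    exact hvn (h2 v (hv ▸ hij))
  have hcover : ∀ q ∈ prefixEvent ℓ L s c, q ∉ prefixEvent ℓ L s s → ∃ i < s, q ∈ J i := by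
    intro q hq hqs
    have hex : ∃ i, i < s ∧ ∃ v, ℓ v = i ∧ q v ∉ L v s := by
      simp only [prefixEvent, Set.mem_ofPred_eq, not_forall] at hqs
      obtain ⟨v, hv, hvn⟩ := hqs
      exact ⟨ℓ v, hv, v, rfl, hvn⟩
    refine ⟨Nat.find hex, (Nat.find_spec hex).1, ?_, (Nat.find_spec hex).2, fun v _ hv => hq v hv⟩
    intro v hv
    by_contra hcon
    exact Nat.find_min hex hv ⟨hv.trans (Nat.find_spec hex).1, v, rfl, hcon⟩
  have hpoint : ∀ q, (prefixEvent ℓ L s c).indicator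
      (fun q => ((s - lastCut ℓ L s q : ℕ) : ℝ≥0∞)) q ≤
      ∑ i ∈ Finset.range s, ((J i).indicator (fun _ => ((s - i : ℕ) : ℝ≥0∞)) q +
        (J i).indicator (fun q => ((i - lastCut ℓ L i q : ℕ) : ℝ≥0∞)) q) := by
    intro q
    by_cases hq : q ∈ prefixEvent ℓ L s c
    · rw [Set.indicator_of_mem hq]
      by_cases hqs : q ∈ prefixEvent ℓ L s s
      · rw [lastCut_eq ℓ L hqs]
        simp
      · obtain ⟨i, hi, hqi⟩ := hcover q hq hqs
        refine le_trans ?_ (Finset.single_le_sum (fun _ _ => zero_le)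
          (Finset.mem_range.2 hi))
        rw [Set.indicator_of_mem hqi, Set.indicator_of_mem hqi]
        have h1 := lastCut_mono ℓ L hi.le q
        have h2 := lastCut_le ℓ L i q
        exact_mod_cast (by omega : s - lastCut ℓ L s q ≤ (s - i) + (i - lastCut ℓ L i q))
    · rw [Set.indicator_of_notMem hq]
      exact zero_le
  have hrec : ∀ i < s, ∫⁻ q, (J i).indicator (fun q => ((i - lastCut ℓ L i q : ℕ) : ℝ≥0∞)) q
      ∂(Measure.pi ν) ≤ Q * K * Measure.pi ν (J i) := by
    intro i hi
    have h1 : ∀ q, (J i).indicator (fun q => ((i - lastCut ℓ L i q : ℕ) : ℝ≥0∞)) q =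
        (prefixEvent ℓ L i s).indicator (fun q => ((i - lastCut ℓ L i q : ℕ) : ℝ≥0∞)) q *
          (R i).indicator 1 q := by
      intro q
      by_cases h1 : q ∈ prefixEvent ℓ L i s <;> by_cases h2 : q ∈ R i <;>
        simp [J, h1, h2]
    simp_rw [h1]
    rw [lintegral_mul_of_dependsOn ν (hdisj i)
      (dependsOn_indicator (dependsOn_prefixEvent ℓ L i s)
        (fun x y h => by rw [dependsOn_lastCut ℓ L i h]))
      (dependsOn_indicator (hR i) (f := 1) (fun _ _ _ => rfl)),
      lintegral_indicator_one MeasurableSet.of_discrete,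
      lintegral_indicator MeasurableSet.of_discrete,
      measure_inter_of_dependsOn ν (hdisj i) (dependsOn_prefixEvent ℓ L i s) (hR i), ← mul_assoc]
    gcongr
    exact ih i hi s hi.le (hsc.trans hcN)
  have htotal : ∑ i ∈ Finset.range s, Measure.pi ν (J i) + Measure.pi ν (prefixEvent ℓ L s s) ≤
      Measure.pi ν (prefixEvent ℓ L s c) := by
    rw [← measure_biUnion_finset _ (fun _ _ => MeasurableSet.of_discrete),
      ← measure_union _ MeasurableSet.of_discrete]
    · refine measure_mono (Set.union_subset (Set.iUnion₂_subset fun i _ => hJE i) ?_)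
      exact fun q hq v hv => hL v hsc (hq v hv)
    · rw [Set.disjoint_iUnion₂_left]
      exact fun i hi => hJs i (Finset.mem_range.1 hi)
    · intro i _ j _ hij
      rcases lt_or_gt_of_ne hij with h | h
      · exact hJdisj i j h
      · exact (hJdisj j i h).symm
  -- Union bound over the coordinates with label `i`, one of which violates level `s`.
  have hjump : ∑ i ∈ Finset.range s, ((s - i : ℕ) : ℝ≥0∞) * Measure.pi ν (J i) ≤
      K * Measure.pi ν (prefixEvent ℓ L s c) := by
    have h1 : ∀ i ∈ Finset.range s, ((s - i : ℕ) : ℝ≥0∞) * Measure.pi ν (J i) ≤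
        ∑ v ∈ (Finset.univ.filter fun v => ℓ v < s) with ℓ v = i,
          ((s - ℓ v : ℕ) : ℝ≥0∞) * b v s c * Measure.pi ν (prefixEvent ℓ L s c) := by
      intro i hi
      have hi' := Finset.mem_range.1 hi
      have hsub : J i ⊆ ⋃ v ∈ (Finset.univ.filter fun v => ℓ v < s).filter (fun v => ℓ v = i),
          prefixEvent ℓ L s c ∩ {q | q v ∉ L v s} := by
        intro q hq
        obtain ⟨v, hv, hvn⟩ := hq.2.1
        simp only [Set.mem_iUnion]
        exact ⟨v, by simp [hv, hi'], hJE i hq, hvn⟩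
      calc _ ≤ ((s - i : ℕ) : ℝ≥0∞) * ∑ v ∈ (Finset.univ.filter fun v => ℓ v < s) with ℓ v = i,
            Measure.pi ν (prefixEvent ℓ L s c ∩ {q | q v ∉ L v s}) := by
            gcongr
            exact (measure_mono hsub).trans (measure_biUnion_finset_le _ _)
        _ ≤ _ := by
            rw [Finset.mul_sum]
            refine Finset.sum_le_sum fun v hv => ?_
            simp only [Finset.mem_filter, Finset.mem_univ, true_and] at hv
            rw [hv.2, mul_assoc]
            gcongr
            exact measure_prefixEvent_inter_notMem_le ℓ L ν hv.1 (hb v s c hv.1 hsc hcN)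
    refine (Finset.sum_le_sum h1).trans ?_
    rw [Finset.sum_fiberwise_of_maps_to (fun v hv => by
      simpa using hv), ← Finset.sum_mul]
    gcongr
    exact hK s c hsc hcN
  rw [← lintegral_indicator MeasurableSet.of_discrete]
  calc _ ≤ ∫⁻ q, ∑ i ∈ Finset.range s, ((J i).indicator (fun _ => ((s - i : ℕ) : ℝ≥0∞)) q +
        (J i).indicator (fun q => ((i - lastCut ℓ L i q : ℕ) : ℝ≥0∞)) q) ∂(Measure.pi ν) :=
        lintegral_mono hpoint
    _ = ∑ i ∈ Finset.range s, (((s - i : ℕ) : ℝ≥0∞) * Measure.pi ν (J i) +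
        ∫⁻ q, (J i).indicator (fun q => ((i - lastCut ℓ L i q : ℕ) : ℝ≥0∞)) q
          ∂(Measure.pi ν)) := by
        rw [lintegral_finsetSum _ fun _ _ => Measurable.of_discrete]
        refine Finset.sum_congr rfl fun i _ => ?_
        rw [lintegral_add_left Measurable.of_discrete,
          lintegral_indicator_const MeasurableSet.of_discrete]
    _ ≤ ∑ i ∈ Finset.range s, (((s - i : ℕ) : ℝ≥0∞) * Measure.pi ν (J i) +
        Q * K * Measure.pi ν (J i)) := by
        refine Finset.sum_le_sum fun i hi => ?_
        gcongr
        exact hrec i (Finset.mem_range.1 hi)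
    _ = ∑ i ∈ Finset.range s, ((s - i : ℕ) : ℝ≥0∞) * Measure.pi ν (J i) +
        Q * K * ∑ i ∈ Finset.range s, Measure.pi ν (J i) := by
        rw [Finset.sum_add_distrib, Finset.mul_sum]
    -- The factor `Q` replaces level `c` by level `s`; the jump cost then fills exactly the share of
    -- `prefixEvent ℓ L s s` that the events `J i` leave free.
    _ ≤ K * (Q * Measure.pi ν (prefixEvent ℓ L s s)) +
        Q * K * ∑ i ∈ Finset.range s, Measure.pi ν (J i) := by
        gcongr
        refine hjump.trans ?_
        gcongr
        exact measure_prefixEvent_le ℓ L ν (fun v hv => ha v s c hv hsc hcN) (hQ s c hsc hcN)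
    _ = Q * K * (∑ i ∈ Finset.range s, Measure.pi ν (J i) +
          Measure.pi ν (prefixEvent ℓ L s s)) := by ring
    _ ≤ _ := by gcongr

end Cuts

/-! ### Sums over pairs on two sides of a cut. -/

section Sums

/-- At most `k` pairs `i < s ≤ j` have difference `k`. With `i = s - 1 - a` and `j = s + b` the
difference is `a + b + 1`, and an antidiagonal of sum `n` has `n + 1` points. -/
theorem sum_sum_Ico_sub_le (f : ℕ → ℝ≥0∞) (s N : ℕ) :
    ∑ i ∈ Finset.range s, ∑ j ∈ Finset.Ico s N, f (j - i) ≤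
      ∑' k : ℕ, ((k + 1 : ℕ) : ℝ≥0∞) * f (k + 1) := by
  calc _ = ∑ a ∈ Finset.range s, ∑ b ∈ Finset.range (N - s), f (a + b + 1) := by
        rw [← Finset.sum_range_reflect]
        refine Finset.sum_congr rfl fun a ha => ?_
        have := Finset.mem_range.1 ha
        rw [Finset.sum_Ico_eq_sum_range]
        refine Finset.sum_congr rfl fun b _ => ?_
        congr 1
        omega
    _ ≤ ∑' a : ℕ, ∑' b : ℕ, f (a + b + 1) :=
        (Finset.sum_le_sum fun a _ => ENNReal.sum_le_tsum _).trans (ENNReal.sum_le_tsum _)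
    _ = ∑' x : ℕ × ℕ, f (x.1 + x.2 + 1) := ENNReal.tsum_prod.symm
    _ = ∑' x : (Σ n : ℕ, Finset.HasAntidiagonal.antidiagonal n), f ((x.2 : ℕ × ℕ).1 + (x.2 : ℕ × ℕ).2 + 1) := by
        rw [← Finset.HasAntidiagonal.sigmaAntidiagonalEquivProd.tsum_eq]
        rfl
    _ = ∑' n : ℕ, ∑' x : Finset.HasAntidiagonal.antidiagonal n, f ((x : ℕ × ℕ).1 + (x : ℕ × ℕ).2 + 1) :=
        ENNReal.tsum_sigma' _
    _ = _ := by
        refine tsum_congr fun n => ?_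
        have h : ∀ x : Finset.HasAntidiagonal.antidiagonal n,
            f ((x : ℕ × ℕ).1 + (x : ℕ × ℕ).2 + 1) = f (n + 1) := fun x => by
          rw [Finset.HasAntidiagonal.mem_antidiagonal.1 x.2]
        simp_rw [h]
        rw [tsum_fintype]
        simp

/-- Since `s ≤ j`, the weight `s - i` is at most `j - i`, which supplies the second factor `k`. -/
theorem sum_sub_mul_sum_Ico_le (f : ℕ → ℝ≥0∞) (s N : ℕ) :
    ∑ i ∈ Finset.range s, ((s - i : ℕ) : ℝ≥0∞) * ∑ j ∈ Finset.Ico s N, f (j - i) ≤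
      ∑' k : ℕ, ((k + 1 : ℕ) : ℝ≥0∞) ^ 2 * f (k + 1) := by
  refine le_trans (Finset.sum_le_sum fun i _ => ?_)
    ((sum_sum_Ico_sub_le (fun k => (k : ℝ≥0∞) * f k) s N).trans_eq ?_)
  · rw [Finset.mul_sum]
    refine Finset.sum_le_sum fun j hj => ?_
    gcongr
    exact (Finset.mem_Ico.1 hj).1
  · refine tsum_congr fun k => ?_
    rw [sq, mul_assoc]

theorem one_add_le_exp (x : ℝ≥0∞) : 1 + x ≤ EReal.exp (x : EReal) := by
  induction x with
  | top => simp
  | coe x =>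
    have h : ((x : ℝ≥0∞) : EReal) = ((x : ℝ) : EReal) := rfl
    rw [h, EReal.exp_coe]
    rw [ENNReal.le_ofReal_iff_toReal_le (by simp) (Real.exp_pos _).le]
    rw [ENNReal.toReal_add (by simp) (by simp)]
    simpa [add_comm] using Real.add_one_le_exp (x : ℝ)

theorem prod_one_add_le_exp {κ : Type*} (s : Finset κ) (f : κ → ℝ≥0∞) :
    ∏ i ∈ s, (1 + f i) ≤ EReal.exp ((∑ i ∈ s, f i : ℝ≥0∞) : EReal) := by
  classical
  induction s using Finset.induction_on with
  | empty => simp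
  | insert i s hi ih =>
    rw [Finset.prod_insert hi, Finset.sum_insert hi, EReal.coe_ennreal_add, EReal.exp_add]
    exact mul_le_mul' (one_add_le_exp _) ih

end Sums

end StableMarriage

namespace StableMarriage

/-! ### The lists conditioned on the revealed information. -/

section Levels

variable {M W : ℕ}

/-- The preference lists of `v` that order the acceptable men who weakly prefer `v` to their
assignment as `p v` does. -/
def revealedEvent (men : Fin M → PrefList W) (A : Fin W → Set (Fin M)) (μ : Matching M W)
    (p : Fin W → PrefList M) (v : Fin W) : Set (PrefList M) :=
  {r | (p v).Agree (μ.proposers men v ∩ A v) r}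

/-- The index of the husband of `v`, and the number of men if `v` is single. -/
def husbandIndex (μ : Matching M W) (v : Fin W) : ℕ := (μ.husband v).elim M fun m => m

/-- The preference lists of `v` that rank her husband before all acceptable men with index at
least `c`. -/
def levelEvent (A : Fin W → Set (Fin M)) (μ : Matching M W) (v : Fin W) (c : ℕ) :
    Set (PrefList M) :=
  {r | ∀ m, μ.husband v = some m → ∀ j ∈ A v, c ≤ (j : ℕ) → r.Prefers (some m) (some j)}

/-- The value `M` given to single women keeps them out of every condition `husbandIndex μ v < s`
with `s ≤ M`. -/
theorem exists_husband_of_husbandIndex_lt {μ : Matching M W} {v : Fin W}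
    (h : husbandIndex μ v < M) : ∃ m : Fin M, μ.husband v = some m ∧ husbandIndex μ v = m := by
  unfold husbandIndex at h ⊢
  cases hm : μ.husband v with
  | none => simp [hm] at h
  | some m => exact ⟨m, rfl, rfl⟩

theorem husbandIndex_eq {μ : Matching M W} {v : Fin W} {m : Fin M} (h : μ.husband v = some m) :
    husbandIndex μ v = m := by
  simp [husbandIndex, h]

theorem injOn_husbandIndex (μ : Matching M W) : Set.InjOn (husbandIndex μ)
    {v | husbandIndex μ v < M} := by
  intro v hv v' hv' h
  obtain ⟨m, hm, hl⟩ := exists_husband_of_husbandIndex_lt hv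
  obtain ⟨m', hm', hl'⟩ := exists_husband_of_husbandIndex_lt hv'
  have : m = m' := Fin.ext (by omega)
  subst this
  have h1 := (μ.consistent _ _).2 hm
  have h2 := (μ.consistent _ _).2 hm'
  rw [h1] at h2
  simpa using h2

theorem levelEvent_mono (A : Fin W → Set (Fin M)) (μ : Matching M W) (v : Fin W) :
    Monotone (levelEvent A μ v) :=
  fun _ _ h _ hr m hm j hj hc => hr m hm j hj (h.trans hc)

/-- At level `M` there is no constraint, so the cut estimate with `c = M` becomes unconditional. -/
theorem levelEvent_eq_univ (A : Fin W → Set (Fin M)) (μ : Matching M W) (v : Fin W) :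
    levelEvent A μ v M = Set.univ :=
  Set.eq_univ_of_forall fun _ _ _ j _ hc => absurd j.2 (not_lt.2 hc)

/-- Otherwise `b` and `v` would block `μ`. -/
theorem Matching.IsStable.prefers_husband {men : Fin M → PrefList W} {p : Fin W → PrefList M}
    {μ : Matching M W} (hμ : μ.IsStable men p) {v : Fin W} {m b : Fin M}
    (hm : μ.husband v = some m) (hb : b ∈ μ.proposers men v) (hne : b ≠ m) :
    (p v).Prefers (some m) (some b) := by
  have h1 : (men b).Prefers (some v) (μ.wife b) := by
    refine lt_of_le_of_ne hb fun h => hne ?_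
    have h2 := (μ.consistent b v).1 ((men b).pos_injective h).symm
    rw [hm] at h2
    simpa using h2.symm
  have h2 : ¬ (p v).Prefers (some b) (some m) := fun h => hμ.2.2 b v ⟨hm ▸ h, h1⟩
  refine lt_of_le_of_ne (not_lt.1 h2) fun h => hne ?_
  simpa using (p v).pos_injective h.symm

theorem Matching.IsStable.husband_mem {men : Fin M → PrefList W} {p : Fin W → PrefList M}
    {μ : Matching M W} (hμ : μ.IsStable men p) {A : Set (Fin M)} {v : Fin W}
    (hp : ∀ m, (p v).Accepts m ↔ m ∈ A) {m : Fin M} (hm : μ.husband v = some m) :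
    m ∈ μ.proposers men v ∩ A := by
  constructor
  · change (men m).pos (some v) ≤ (men m).pos (μ.wife m)
    rw [(μ.consistent m v).2 hm]
  · have h := hμ.2.1 v
    rw [hm] at h
    refine (hp m).1 (lt_of_le_of_ne (not_lt.1 h) fun h => ?_)
    simpa using (p v).pos_injective h

theorem cond_le_of_inter_le {D : Measure (PrefList M)} {E B C : Set (PrefList M)}
    {a : ℝ≥0∞} (h : D (E ∩ B) ≤ a * D (E ∩ C)) :
    cond (D) E B ≤ a * cond (D) E C := by
  rw [cond_apply MeasurableSet.of_discrete, cond_apply MeasurableSet.of_discrete]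
  calc _ ≤ (D E)⁻¹ * (a * D (E ∩ C)) := by gcongr
    _ = _ := by ring

section Revealed

variable {men : Fin M → PrefList W} {A : Fin W → Set (Fin M)} {μ : Matching M W}
  {p : Fin W → PrefList M} {D : Fin W → Measure (PrefList M)} [∀ w, IsProbabilityMeasure (D w)]

theorem prefers_of_mem_revealedEvent (hμ : μ.IsStable men p) {v : Fin W}
    (hp : ∀ m, (p v).Accepts m ↔ m ∈ A v) {m b : Fin M} (hm : μ.husband v = some m)
    {r : PrefList M} (hr : r ∈ revealedEvent men A μ p v)
    (hb : b ∈ μ.proposers men v ∩ A v) (hne : b ≠ m) : r.Prefers (some m) (some b) :=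
  (hr m (hμ.husband_mem hp hm) b hb).1 (hμ.prefers_husband hm hb.1 hne)

theorem mem_revealedEvent_of_agree {v : Fin W} {r r' : PrefList M}
    (hr : r ∈ revealedEvent men A μ p v) (h : r.Agree (μ.proposers men v ∩ A v) r') :
    r' ∈ revealedEvent men A μ p v :=
  fun a ha b hb => (hr a ha b hb).trans (h a ha b hb)

/-- These are the hypotheses `hE` and `hbest` of the regularity lemmas, for the revealed men
together with the acceptable men of index at least `c`. -/
theorem level_determined (hμ : μ.IsStable men p) {v : Fin W}
    (hp : ∀ m, (p v).Accepts m ↔ m ∈ A v) {m : Fin M} (hm : μ.husband v = some m) {c : ℕ} :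
    (∀ r ∈ revealedEvent men A μ p v ∩ levelEvent A μ v c, ∀ r',
      r.Agree (μ.proposers men v ∩ A v ∪ {j | j ∈ A v ∧ c ≤ (j : ℕ)}) r' →
      r' ∈ revealedEvent men A μ p v ∩ levelEvent A μ v c) ∧
    (∀ r ∈ revealedEvent men A μ p v ∩ levelEvent A μ v c,
      ∀ b ∈ μ.proposers men v ∩ A v ∪ {j | j ∈ A v ∧ c ≤ (j : ℕ)}, b ≠ m →
      r.Prefers (some m) (some b)) := by
  constructor
  · rintro r ⟨h1, h2⟩ r' h
    refine ⟨mem_revealedEvent_of_agree h1 (h.mono Set.subset_union_left), ?_⟩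
    intro m' hm' j hj hc
    rw [hm] at hm'
    obtain rfl : m = m' := by simpa using hm'
    exact (h m (Or.inl (hμ.husband_mem hp hm)) j (Or.inr ⟨hj, hc⟩)).1 (h2 m hm j hj hc)
  · rintro r ⟨h1, h2⟩ b (hb | hb) hne
    · exact prefers_of_mem_revealedEvent hμ hp hm h1 hb hne
    · exact h2 m hm b hb.1 hb.2

/-- Between the levels `c + 1` and `c` the only new competitor of the husband `m` is the man of
index `c`, if he is acceptable. -/
theorem measure_level_succ (hμ : μ.IsStable men p) {v : Fin W}
    (hp : ∀ m, (p v).Accepts m ↔ m ∈ A v) (hD : IsRegular (D v) (A v))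
    (hfin : ∀ k, maxOdds D A (k + 1) ≠ ∞) {m : Fin M}
    (hm : μ.husband v = some m) {c : ℕ} (hmc : (m : ℕ) < c) (hc : c < M) :
    D v (revealedEvent men A μ p v ∩ levelEvent A μ v (c + 1)) ≤ (1 + maxOdds D A (c - m)) *
      D v (revealedEvent men A μ p v ∩ levelEvent A μ v c) ∧
    D v (revealedEvent men A μ p v ∩ (levelEvent A μ v (c + 1) \ levelEvent A μ v c)) ≤
      maxOdds D A (c - m) * D v (revealedEvent men A μ p v ∩ levelEvent A μ v (c + 1)) := by
  have hmA := hμ.husband_mem hp hm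
  by_cases hcA : (⟨c, hc⟩ : Fin M) ∈ A v
  · obtain ⟨h1, h2⟩ := level_determined (c := c + 1) hμ hp hm
    have hlt : m < ⟨c, hc⟩ := hmc
    have hT : μ.proposers men v ∩ A v ∪ {j | j ∈ A v ∧ c + 1 ≤ (j : ℕ)} ⊆ A v :=
      Set.union_subset Set.inter_subset_right fun j hj => hj.1
    have hfin' : maxOdds D A (c - m) ≠ ∞ := by
      have := hfin (c - m - 1)
      rwa [show c - m - 1 + 1 = c - m by omega] at this
    constructor
    · refine (measure_le_one_add_maxOdds_mul hD hlt hcA hfin' hT (Or.inl hmA) h1 h2).trans ?_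
      refine mul_le_mul_right (measure_mono ?_) _
      rintro r ⟨h3, h4, h5⟩
      refine ⟨h4, fun m' hm' j hj hcj => ?_⟩
      rcases hcj.eq_or_lt with h | h
      · rw [hm] at hm'
        obtain rfl : m = m' := by simpa using hm'
        obtain rfl : (⟨c, hc⟩ : Fin M) = j := Fin.ext h
        exact h3
      · exact h5 m' hm' j hj h
    · refine le_trans (measure_mono ?_)
        ((hD.measure_rankedBefore_inter_le hT hcA (Or.inl hmA) h1 h2).trans
          (mul_le_mul_left (measure_rankedBefore_le_maxOdds hlt hmA.2 hcA) _))
      rintro r ⟨h3, h4, h5⟩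
      refine ⟨?_, h3, h4⟩
      by_contra hcon
      refine h5 fun m' hm' j hj hcj => ?_
      rcases hcj.eq_or_lt with h | h
      · rw [hm] at hm'
        obtain rfl : m = m' := by simpa using hm'
        obtain rfl : (⟨c, hc⟩ : Fin M) = j := Fin.ext h
        refine lt_of_le_of_ne (not_lt.1 hcon) fun h => hlt.ne ?_
        simpa using r.pos_injective h
      · exact h4 m' hm' j hj h
  · have heq : levelEvent A μ v (c + 1) = levelEvent A μ v c := by
      refine Set.Subset.antisymm (fun r hr m' hm' j hj hcj => hr m' hm' j hj ?_)
        (levelEvent_mono A μ v (Nat.le_succ c))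
      refine Nat.succ_le_of_lt (lt_of_le_of_ne hcj ?_)
      rintro rfl
      exact hcA hj
    rw [heq]
    refine ⟨?_, by simp⟩
    exact le_mul_of_one_le_left' le_self_add

theorem measure_level_le (hμ : μ.IsStable men p) {v : Fin W}
    (hp : ∀ m, (p v).Accepts m ↔ m ∈ A v) (hD : IsRegular (D v) (A v))
    (hfin : ∀ k, maxOdds D A (k + 1) ≠ ∞) {m : Fin M}
    (hm : μ.husband v = some m) {s c : ℕ} (hms : (m : ℕ) < s) (hsc : s ≤ c) (hc : c ≤ M) :
    D v (revealedEvent men A μ p v ∩ levelEvent A μ v c) ≤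
      (∏ j ∈ Finset.Ico s c, (1 + maxOdds D A (j - m))) *
      D v (revealedEvent men A μ p v ∩ levelEvent A μ v s) ∧
    D v (revealedEvent men A μ p v ∩ (levelEvent A μ v c \ levelEvent A μ v s)) ≤
      (∑ j ∈ Finset.Ico s c, maxOdds D A (j - m)) *
        D v (revealedEvent men A μ p v ∩ levelEvent A μ v c) := by
  induction c, hsc using Nat.le_induction with
  | base => simp
  | succ c hsc ih =>
    obtain ⟨ih1, ih2⟩ := ih (by omega)
    obtain ⟨h1, h2⟩ := measure_level_succ hμ hp hD hfin hm (lt_of_lt_of_le hms hsc) hc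
    rw [Finset.prod_Ico_succ_top hsc, Finset.sum_Ico_succ_top hsc]
    constructor
    · calc _ ≤ _ := h1
        _ ≤ _ := mul_le_mul_right ih1 _
        _ = _ := by ring
    · rw [add_mul]
      calc _ ≤ D v (revealedEvent men A μ p v ∩ (levelEvent A μ v c \ levelEvent A μ v s) ∪
            revealedEvent men A μ p v ∩ (levelEvent A μ v (c + 1) \ levelEvent A μ v c)) := by
            refine measure_mono ?_
            rintro r ⟨h3, h4, h5⟩
            by_cases h6 : r ∈ levelEvent A μ v c
            · exact Or.inl ⟨h3, h6, h5⟩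
            · exact Or.inr ⟨h3, h4, h6⟩
        _ ≤ _ := measure_union_le _ _
        _ ≤ _ := add_le_add (ih2.trans (by
            gcongr
            exact levelEvent_mono A μ v (Nat.le_succ c))) h2

theorem cond_rankedBefore_husband_le (hμ : μ.IsStable men p) {v : Fin W}
    (hp : ∀ m, (p v).Accepts m ↔ m ∈ A v) (hD : IsRegular (D v) (A v)) {m j : Fin M}
    (hm : μ.husband v = some m) (hmj : m < j) (hj : j ∈ A v) :
    cond (D v) (revealedEvent men A μ p v) (rankedBefore j m) ≤ maxOdds D A (j - m) := by
  have hmA := hμ.husband_mem hp hm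
  have h := hD.measure_rankedBefore_inter_le (E := revealedEvent men A μ p v)
    Set.inter_subset_right hj hmA (fun r hr r' h => mem_revealedEvent_of_agree hr h)
    (fun r hr b hb hne => prefers_of_mem_revealedEvent hμ hp hm hr hb hne)
  have h' : D v (revealedEvent men A μ p v ∩ rankedBefore j m) ≤
      maxOdds D A (j - m) * D v (revealedEvent men A μ p v) := by
    rw [Set.inter_comm]
    exact h.trans (mul_le_mul_left (measure_rankedBefore_le_maxOdds hmj hmA.2 hj) _)
  rw [cond_apply MeasurableSet.of_discrete]
  calc _ ≤ (D v (revealedEvent men A μ p v))⁻¹ *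
        (maxOdds D A (j - m) * D v (revealedEvent men A μ p v)) := by gcongr
    _ = maxOdds D A (j - m) * ((D v (revealedEvent men A μ p v))⁻¹ *
        D v (revealedEvent men A μ p v)) := by ring
    _ ≤ maxOdds D A (j - m) * 1 := by gcongr; exact ENNReal.inv_mul_le_one _
    _ = _ := mul_one _

/-- Once `j` is ranked before the husband, `j` heads the revealed men, so regularity applies with
`j` at the head of the chain. -/
theorem cond_rankedBefore_inter_le (hμ : μ.IsStable men p) {v : Fin W}
    (hp : ∀ m, (p v).Accepts m ↔ m ∈ A v) (hD : IsRegular (D v) (A v)) {m j y : Fin M}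
    (hm : μ.husband v = some m) (hjy : j < y) (hj : j ∈ A v) (hy : y ∈ A v) :
    cond (D v) (revealedEvent men A μ p v) (rankedBefore y j ∩ rankedBefore j m) ≤
      maxOdds D A (y - j) := by
  have hmA := hμ.husband_mem hp hm
  have h := hD.measure_rankedBefore_inter_le (T := insert j (μ.proposers men v ∩ A v))
    (E := revealedEvent men A μ p v ∩ rankedBefore j m)
    (Set.insert_subset hj Set.inter_subset_right) hy (Set.mem_insert _ _)
    (fun r hr r' h => ⟨mem_revealedEvent_of_agree hr.1 (h.mono (Set.subset_insert _ _)),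
      (h j (Or.inl rfl) m (Or.inr hmA)).1 hr.2⟩)
    (fun r hr b hb hne => by
      rcases hb with hb | hb
      · exact absurd hb hne
      · by_cases hbm : b = m
        · rw [hbm]; exact hr.2
        · exact lt_trans hr.2 (prefers_of_mem_revealedEvent hμ hp hm hr.1 hb hbm))
  have h' : D v (revealedEvent men A μ p v ∩ (rankedBefore y j ∩ rankedBefore j m)) ≤
      maxOdds D A (y - j) * D v (revealedEvent men A μ p v) := by
    rw [Set.inter_left_comm]
    exact h.trans (mul_le_mul' (measure_rankedBefore_le_maxOdds hjy hj hy)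
      (measure_mono Set.inter_subset_left))
  rw [cond_apply MeasurableSet.of_discrete]
  calc _ ≤ (D v (revealedEvent men A μ p v))⁻¹ *
        (maxOdds D A (y - j) * D v (revealedEvent men A μ p v)) := by gcongr
    _ = maxOdds D A (y - j) * ((D v (revealedEvent men A μ p v))⁻¹ *
        D v (revealedEvent men A μ p v)) := by ring
    _ ≤ maxOdds D A (y - j) * 1 := by gcongr; exact ENNReal.inv_mul_le_one _
    _ = _ := mul_one _

end Revealed

/-! ### Bounding the rank gap by three counts. -/

section Gap

open Classical in
/-- The number of acceptable men with index larger than that of `x` and ranked before `x`. -/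
noncomputable def upperCount (A : Set (Fin M)) (x : Fin M) (r : PrefList M) : ℝ≥0∞ :=
  ∑ j with x < j ∧ j ∈ A, (rankedBefore j x).indicator 1 r

open Classical in
/-- The number of pairs of acceptable men, one with index less than `s` and the other with index at
least `s`, such that the second is ranked before the first and the first before `x`. -/
noncomputable def crossCount (A : Set (Fin M)) (x : Fin M) (s : ℕ) (r : PrefList M) : ℝ≥0∞ :=
  ∑ j ∈ Finset.univ.filter fun j : Fin M => (j : ℕ) < s ∧ j ∈ A,
    ∑ y ∈ Finset.univ.filter fun y : Fin M => s ≤ (y : ℕ) ∧ y ∈ A,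
    (rankedBefore y j ∩ rankedBefore j x).indicator 1 r

theorem card_le_sum_indicator {κ : Type*} (F G : Finset κ) (f : κ → ℝ≥0∞) (hFG : F ⊆ G)
    (h : ∀ k ∈ F, 1 ≤ f k) : (F.card : ℝ≥0∞) ≤ ∑ k ∈ G, f k := by
  calc (F.card : ℝ≥0∞) = ∑ k ∈ F, 1 := by simp
    _ ≤ ∑ k ∈ F, f k := Finset.sum_le_sum h
    _ ≤ _ := Finset.sum_le_sum_of_subset hFG

/-- The positions from that of `b` up to that of `x`, the latter excluded, are held by men only, as
`x` is acceptable. These men, forming `F`, are sorted by index: above `x`, in `[s, x)`, or below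
`s`. -/
theorem pos_sub_le_counts {A : Set (Fin M)} {r : PrefList M} (hr : ∀ m, r.Accepts m ↔ m ∈ A)
    {x b : Fin M} (hx : x ∈ A) {s : ℕ} (hsx : s ≤ x) (hsb : s ≤ (b : ℕ)) :
    ((r.pos (some x) - r.pos (some b) : ℕ) : ℝ≥0∞) ≤
      upperCount A x r + ((x - s : ℕ) : ℝ≥0∞) + crossCount A x s r := by
  classical
  let F : Finset (Fin M) := {k | r.pos (some b) ≤ r.pos (some k) ∧ r.Prefers (some k) (some x)}
  have hFA : ∀ k ∈ F, k ∈ A := by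
    intro k hk
    rw [← hr]
    exact lt_trans (Finset.mem_filter.1 hk).2.2 ((hr x).2 hx)
  have hcard : r.pos (some x) - r.pos (some b) ≤ F.card := by
    rw [← Nat.card_Ico]
    refine (Finset.card_le_card ?_).trans
      (Finset.card_image_le (s := F) (f := fun k => r.pos (some k)))
    intro i hi
    obtain ⟨h1, h2⟩ := Finset.mem_Ico.1 hi
    have hiM : i < M + 1 := h2.trans (Fin.is_lt _)
    obtain ⟨o, ho⟩ := Equiv.surjective (α := Option (Fin M)) (β := Fin (M + 1)) r ⟨i, hiM⟩
    have ho' : r.pos o = i := congrArg Fin.val ho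
    cases o with
    | none =>
      have : r.pos (some x) < r.pos none := (hr x).2 hx
      omega
    | some k =>
      refine Finset.mem_image.2 ⟨k, Finset.mem_filter.2 ⟨Finset.mem_univ _, ?_, ?_⟩, ho'⟩
      · omega
      · change r.pos (some k) < r.pos (some x)
        omega
  let F1 := F.filter fun k => x < k
  let F2 := F.filter fun k : Fin M => s ≤ (k : ℕ) ∧ k < x
  let F3 := F.filter fun k : Fin M => (k : ℕ) < s
  have hF : F ⊆ F1 ∪ F2 ∪ F3 := by
    intro k hk
    simp only [F1, F2, F3, Finset.mem_union, Finset.mem_filter, hk, true_and]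
    have hkx : k ≠ x := by
      rintro rfl
      exact lt_irrefl _ (Finset.mem_filter.1 hk).2.2
    rcases lt_or_gt_of_ne hkx with h | h
    · by_cases hs : s ≤ (k : ℕ)
      · exact Or.inl (Or.inr ⟨hs, h⟩)
      · exact Or.inr (not_le.1 hs)
    · exact Or.inl (Or.inl h)
  have h1 : (F1.card : ℝ≥0∞) ≤ upperCount A x r := by
    refine card_le_sum_indicator _ _ _ (fun k hk => ?_) (fun k hk => ?_)
    · have hk' := Finset.mem_filter.1 hk
      exact Finset.mem_filter.2 ⟨Finset.mem_univ _, hk'.2, hFA k hk'.1⟩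
    · rw [Set.indicator_of_mem]
      · rfl
      · exact (Finset.mem_filter.1 (Finset.mem_filter.1 hk).1).2.2
  have h2 : F2.card ≤ x - s := by
    rw [← Nat.card_Ico]
    refine Finset.card_le_card_of_injOn (fun k : Fin M => (k : ℕ)) (fun k hk => ?_)
      (fun _ _ _ _ h => Fin.ext h)
    have := (Finset.mem_filter.1 hk).2
    exact Finset.mem_coe.2 (Finset.mem_Ico.2 ⟨this.1, this.2⟩)
  -- For a man `k` of index below `s`, the pair counted is `(k, b)`: `b` has index at least `s` and
  -- is ranked before `k`.
  have h3 : (F3.card : ℝ≥0∞) ≤ crossCount A x s r := by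
    refine card_le_sum_indicator _ _ _ (fun k hk => ?_) (fun k hk => ?_)
    · have hk' := Finset.mem_filter.1 hk
      exact Finset.mem_filter.2 ⟨Finset.mem_univ _, hk'.2, hFA k hk'.1⟩
    · obtain ⟨hkF, hks⟩ := Finset.mem_filter.1 hk
      obtain ⟨hbk, hkx⟩ := (Finset.mem_filter.1 hkF).2
      have hbk' : r.Prefers (some b) (some k) := by
        refine lt_of_le_of_ne hbk fun h => ?_
        have : b = k := by simpa using r.pos_injective h
        omega
      have hbA : b ∈ A := (hr b).1 (lt_trans (lt_trans hbk' hkx) ((hr x).2 hx))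
      refine le_trans ?_ (Finset.single_le_sum (fun _ _ => zero_le)
        (Finset.mem_filter.2 ⟨Finset.mem_univ b, hsb, hbA⟩))
      rw [Set.indicator_of_mem]
      · rfl
      · exact ⟨hbk', hkx⟩
  have hle : F.card ≤ F1.card + F2.card + F3.card :=
    (Finset.card_le_card hF).trans ((Finset.card_union_le _ _).trans
      (Nat.add_le_add_right (Finset.card_union_le _ _) _))
  calc ((r.pos (some x) - r.pos (some b) : ℕ) : ℝ≥0∞)
      ≤ ((F1.card + F2.card + F3.card : ℕ) : ℝ≥0∞) := by exact_mod_cast hcard.trans hle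
    _ = F1.card + F2.card + F3.card := by push_cast; rfl
    _ ≤ _ := by gcongr

/-- The men below the last cut `s` form a separator. The husband `x` of `w` has index at least `s`,
so `w` has no stable partner below `s`; and `x` is her least preferred stable partner. -/
theorem stableRankGap_le_counts {men : Fin M → PrefList W} {A : Fin W → Set (Fin M)}
    {μ : Matching M W} {q : Fin W → PrefList M} (hq : ∀ v m, (q v).Accepts m ↔ m ∈ A v)
    (hμ : μ.IsStable men q) (hopt : μ.IsManOptimal men q) {w : Fin W} {x : Fin M}
    (hx : μ.husband w = some x) :
    stableRankGap men q w ≤ upperCount (A w) x (q w) +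
      ((x - lastCut (husbandIndex μ) (levelEvent A μ) x q : ℕ) : ℝ≥0∞) +
      crossCount (A w) x (lastCut (husbandIndex μ) (levelEvent A μ) x q) (q w) := by
  set s := lastCut (husbandIndex μ) (levelEvent A μ) x q with hs
  have hsx : s ≤ x := lastCut_le _ _ _ _
  have hcut := mem_prefixEvent_lastCut (husbandIndex μ) (levelEvent A μ) x q
  rw [← hs] at hcut
  have hxA := (hμ.husband_mem (hq w) hx).2
  have hge : ∀ m ∈ stablePartners men q w, s ≤ (m : ℕ) := by
    rintro m ⟨ν, hν, hm⟩
    by_contra hcon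
    refine hopt.husband_notMem_of_separator hμ hν {m : Fin M | (m : ℕ) < s} ?_ ?_ m
      (not_le.1 hcon) hm
    · intro m₀ hm₀ v hv m' hm'
      have hh := (μ.consistent _ _).1 hv
      by_cases hA : m' ∈ A v
      · exact hcut v (by rw [husbandIndex_eq hh]; exact hm₀) m₀ hh m' hA (not_lt.1 hm')
      · have h1 : (q v).Prefers (some m₀) none := (hq v m₀).2 (hμ.husband_mem (hq v) hh).2
        exact lt_of_lt_of_le h1 (not_lt.1 fun h => hA ((hq v m').1 h))
    · intro m₀ hm₀ h
      have hh := (μ.consistent _ _).1 h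
      rw [hx] at hh
      obtain rfl : x = m₀ := by simpa using hh
      exact absurd hm₀ (not_lt.2 hsx)
  have hle : ∀ m ∈ stablePartners men q w, (q w).pos (some m) ≤ (q w).pos (some x) := by
    rintro m ⟨ν, hν, hm⟩
    have := hopt.husband_le hν w
    rwa [hm, hx] at this
  unfold stableRankGap
  refine iSup₂_le fun m hm => iSup₂_le fun m' hm' => ?_
  have h1 := hle m hm
  have h2 := hle m' hm'
  rcases le_total ((q w).pos (some m)) ((q w).pos (some m')) with h | h
  · refine le_trans ?_ (pos_sub_le_counts (hq w) hxA hsx (hge m hm))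
    refine Nat.cast_le.2 ?_
    omega
  · refine le_trans ?_ (pos_sub_le_counts (hq w) hxA hsx (hge m' hm'))
    refine Nat.cast_le.2 ?_
    omega

end Gap

end Levels

end StableMarriage

namespace StableMarriage

/-! ### Expectations, first given the revealed information and then averaged. -/

section Expectation

variable {M W : ℕ}

theorem sum_comp_le_sum {κ : Type*} (F : Finset κ) (G : Finset ℕ) {e : κ → ℕ}
    (he : Set.InjOn e F) (h : ∀ k ∈ F, e k ∈ G) (f : ℕ → ℝ≥0∞) :
    ∑ k ∈ F, f (e k) ≤ ∑ i ∈ G, f i := by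
  classical
  rw [← Finset.sum_image he]
  exact Finset.sum_le_sum_of_subset (Finset.image_subset_iff.2 h)

/-- `∑ k ≥ 1, k * u k`. -/
noncomputable def oddsSum (D : Fin W → Measure (PrefList M)) (A : Fin W → Set (Fin M)) : ℝ≥0∞ :=
  ∑' k : ℕ, ((k + 1 : ℕ) : ℝ≥0∞) * maxOdds D A (k + 1)

/-- `∑ k ≥ 1, k ^ 2 * u k`. -/
noncomputable def oddsSqSum (D : Fin W → Measure (PrefList M)) (A : Fin W → Set (Fin M)) :
    ℝ≥0∞ :=
  ∑' k : ℕ, ((k + 1 : ℕ) : ℝ≥0∞) ^ 2 * maxOdds D A (k + 1)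

theorem oddsSum_le_oddsSqSum (D : Fin W → Measure (PrefList M)) (A : Fin W → Set (Fin M)) :
    oddsSum D A ≤ oddsSqSum D A := by
  refine ENNReal.tsum_le_tsum fun k => ?_
  gcongr
  exact le_self_pow (by simp) two_ne_zero

/-- Conditioning on a box preserves independence, which the cut estimate needs. -/
theorem cond_pi_univ_pi {ι X : Type*} [Fintype ι] [MeasurableSpace X]
    [DiscreteMeasurableSpace X] (D : ι → Measure X) [∀ i, IsProbabilityMeasure (D i)]
    (E : ι → Set X) (h : Measure.pi D (Set.univ.pi E) ≠ 0) :
    cond (Measure.pi D) (Set.univ.pi E) = Measure.pi fun i => cond (D i) (E i) := by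
  have h0 : ∀ i, D i (E i) ≠ 0 := by
    rw [Measure.pi_pi, Finset.prod_ne_zero_iff] at h
    exact fun i => h i (Finset.mem_univ i)
  have : ∀ i, IsProbabilityMeasure (cond (D i) (E i)) := fun i =>
    cond_isProbabilityMeasure (h0 i)
  refine (Measure.pi_eq fun s _ => ?_).symm
  rw [cond_apply (MeasurableSet.univ_pi fun i => MeasurableSet.of_discrete),
    ← Set.pi_inter_distrib, Measure.pi_pi, Measure.pi_pi,
    ENNReal.prod_inv_distrib, ← Finset.prod_mul_distrib]
  · refine Finset.prod_congr rfl fun i _ => ?_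
    rw [cond_apply MeasurableSet.of_discrete]
  · exact fun i _ j _ _ => Or.inr (measure_ne_top _ _)

variable {men : Fin M → PrefList W} {A : Fin W → Set (Fin M)} {μ : Matching M W}
  {p : Fin W → PrefList M} {D : Fin W → Measure (PrefList M)} [∀ w, IsProbabilityMeasure (D w)]

theorem lintegral_upperCount_le (hμ : μ.IsStable men p) {v : Fin W}
    (hp : ∀ m, (p v).Accepts m ↔ m ∈ A v) (hD : IsRegular (D v) (A v)) {m : Fin M}
    (hm : μ.husband v = some m) :
    ∫⁻ r, upperCount (A v) m r ∂(cond (D v) (revealedEvent men A μ p v)) ≤ oddsSum D A := by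
  classical
  unfold upperCount
  rw [lintegral_finsetSum _ fun _ _ => Measurable.of_discrete]
  calc _ ≤ ∑ j with m < j ∧ j ∈ A v, maxOdds D A ((j : ℕ) - m) := by
        refine Finset.sum_le_sum fun j hj => ?_
        rw [lintegral_indicator_one MeasurableSet.of_discrete]
        have hj' := (Finset.mem_filter.1 hj).2
        exact cond_rankedBefore_husband_le hμ hp hD hm hj'.1 hj'.2
    _ ≤ ∑ j ∈ Finset.Ico ((m : ℕ) + 1) M, maxOdds D A (j - m) := by
        refine sum_comp_le_sum _ _ (e := fun j : Fin M => (j : ℕ))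
          (fun _ _ _ _ h => Fin.ext h) (fun j hj => ?_) fun j => maxOdds D A (j - m)
        exact Finset.mem_Ico.2 ⟨(Finset.mem_filter.1 hj).2.1, j.2⟩
    -- The sum is the row `i = m` of the double sum with `s = m + 1`.
    _ ≤ ∑ i ∈ Finset.range ((m : ℕ) + 1), ∑ j ∈ Finset.Ico ((m : ℕ) + 1) M,
          maxOdds D A (j - i) :=
        Finset.single_le_sum (f := fun i => ∑ j ∈ Finset.Ico ((m : ℕ) + 1) M,
          maxOdds D A (j - i)) (fun _ _ => zero_le) (Finset.self_mem_range_succ _)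
    _ ≤ _ := sum_sum_Ico_sub_le _ _ _

theorem lintegral_crossCount_le (hμ : μ.IsStable men p) {v : Fin W}
    (hp : ∀ m, (p v).Accepts m ↔ m ∈ A v) (hD : IsRegular (D v) (A v)) {m : Fin M}
    (hm : μ.husband v = some m) (s : ℕ) :
    ∫⁻ r, crossCount (A v) m s r ∂(cond (D v) (revealedEvent men A μ p v)) ≤ oddsSum D A := by
  classical
  unfold crossCount
  rw [lintegral_finsetSum _ fun _ _ => Measurable.of_discrete]
  calc _ ≤ ∑ j ∈ Finset.univ.filter fun j : Fin M => (j : ℕ) < s ∧ j ∈ A v,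
        ∑ y ∈ Finset.Ico s M, maxOdds D A (y - j) := by
        refine Finset.sum_le_sum fun j hj => ?_
        have hj' := (Finset.mem_filter.1 hj).2
        rw [lintegral_finsetSum _ fun _ _ => Measurable.of_discrete]
        refine le_trans (Finset.sum_le_sum (g := fun y : Fin M => maxOdds D A ((y : ℕ) - j))
          fun y hy => ?_) ?_
        · have hy' := (Finset.mem_filter.1 hy).2
          rw [lintegral_indicator_one MeasurableSet.of_discrete]
          have hjy : j < y := Fin.lt_def.2 (lt_of_lt_of_le hj'.1 hy'.1)
          exact cond_rankedBefore_inter_le hμ hp hD hm hjy hj'.2 hy'.2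
        · refine sum_comp_le_sum _ _ (e := fun j : Fin M => (j : ℕ))
            (fun _ _ _ _ h => Fin.ext h) (fun y hy => ?_) fun y => maxOdds D A (y - j)
          exact Finset.mem_Ico.2 ⟨(Finset.mem_filter.1 hy).2.1, y.2⟩
    _ ≤ ∑ i ∈ Finset.range s, ∑ y ∈ Finset.Ico s M, maxOdds D A (y - i) := by
        refine sum_comp_le_sum _ _ (e := fun j : Fin M => (j : ℕ))
          (fun _ _ _ _ h => Fin.ext h) (fun j hj => ?_)
          fun i => ∑ y ∈ Finset.Ico s M, maxOdds D A (y - i)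
        exact Finset.mem_range.2 (Finset.mem_filter.1 hj).2.1
    _ ≤ _ := sum_sum_Ico_sub_le _ _ _

/-- The cut estimate with `Q = exp (∑ k u_k)` and `K = ∑ k² u_k`. Distinct women have distinct
husbands, so each index below `s` enters the products and sums at most once. -/
theorem lintegral_sub_lastCut_husbandIndex_le (hμ : μ.IsStable men p)
    (hp : ∀ v m, (p v).Accepts m ↔ m ∈ A v) (hD : ∀ v, IsRegular (D v) (A v))
    (hfin : ∀ k, maxOdds D A (k + 1) ≠ ∞) (h0 : ∀ v, D v (revealedEvent men A μ p v) ≠ 0)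
    {s : ℕ} (hs : s ≤ M) :
    ∫⁻ q, ((s - lastCut (husbandIndex μ) (levelEvent A μ) s q : ℕ) : ℝ≥0∞)
        ∂(Measure.pi fun v => cond (D v) (revealedEvent men A μ p v)) ≤
      EReal.exp (oddsSum D A : EReal) * oddsSqSum D A := by
  classical
  have : ∀ v, IsProbabilityMeasure (cond (D v) (revealedEvent men A μ p v)) := fun v =>
    cond_isProbabilityMeasure (h0 v)
  have hinj : ∀ s c, s ≤ c → c ≤ M → Set.InjOn (husbandIndex μ)
      (Finset.univ.filter fun v => husbandIndex μ v < s : Finset (Fin W)) := by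
    intro s c hsc hc
    refine (injOn_husbandIndex μ).mono fun v hv => ?_
    have := (Finset.mem_filter.1 (Finset.mem_coe.1 hv)).2
    exact lt_of_lt_of_le this (hsc.trans hc)
  have hrange : ∀ s, ∀ v ∈ (Finset.univ.filter fun v => husbandIndex μ v < s),
      husbandIndex μ v ∈ Finset.range s := fun s v hv =>
    Finset.mem_range.2 (Finset.mem_filter.1 hv).2
  have hlevel : ∀ v s c, husbandIndex μ v < s → s ≤ c → c ≤ M →
      D v (revealedEvent men A μ p v ∩ levelEvent A μ v c) ≤
        (∏ j ∈ Finset.Ico s c, (1 + maxOdds D A (j - husbandIndex μ v))) *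
        D v (revealedEvent men A μ p v ∩ levelEvent A μ v s) ∧
      D v (revealedEvent men A μ p v ∩ (levelEvent A μ v c \ levelEvent A μ v s)) ≤
        (∑ j ∈ Finset.Ico s c, maxOdds D A (j - husbandIndex μ v)) *
          D v (revealedEvent men A μ p v ∩ levelEvent A μ v c) := by
    intro v s c hv hsc hc
    obtain ⟨m, hm, hl⟩ := exists_husband_of_husbandIndex_lt (hv.trans_le (hsc.trans hc))
    rw [hl] at hv ⊢
    exact measure_level_le hμ (hp v) (hD v) hfin hm hv hsc hc
  have h := lintegral_sub_lastCut_le (husbandIndex μ) (levelEvent A μ)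
    (fun v => cond (D v) (revealedEvent men A μ p v)) (levelEvent_mono A μ) (N := M)
    (Q := EReal.exp (oddsSum D A : EReal)) (K := oddsSqSum D A)
    (fun v s c => ∏ j ∈ Finset.Ico s c, (1 + maxOdds D A (j - husbandIndex μ v)))
    (fun v s c => ∑ j ∈ Finset.Ico s c, maxOdds D A (j - husbandIndex μ v))
    (fun v s c hv hsc hc => cond_le_of_inter_le (hlevel v s c hv hsc hc).1)
    (fun v s c hv hsc hc => cond_le_of_inter_le (hlevel v s c hv hsc hc).2)
    (fun s c hsc hc => by
      rw [← Finset.prod_product']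
      refine (prod_one_add_le_exp _ _).trans (EReal.exp_monotone ?_)
      rw [EReal.coe_ennreal_le_coe_ennreal_iff]
      rw [Finset.sum_product]
      exact (sum_comp_le_sum _ _ (hinj s c hsc hc) (hrange s)
        fun i => ∑ j ∈ Finset.Ico s c, maxOdds D A (j - i)).trans (sum_sum_Ico_sub_le _ _ _))
    (fun s c hsc hc =>
      (sum_comp_le_sum _ _ (hinj s c hsc hc) (hrange s)
        fun i => ((s - i : ℕ) : ℝ≥0∞) * ∑ j ∈ Finset.Ico s c, maxOdds D A (j - i)).trans
        (sum_sub_mul_sum_Ico_le _ _ _))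
    s M hs le_rfl
  have huniv : prefixEvent (husbandIndex μ) (levelEvent A μ) s M = Set.univ :=
    Set.eq_univ_of_forall fun q v _ => by rw [levelEvent_eq_univ]; trivial
  rwa [huniv, Measure.restrict_univ, measure_univ, mul_one] at h

/-- The last cut up to `x` depends only on women with a husband of index below `x`, hence not on the
list of `w`. The cut may be frozen at each of its values `s`, with a bound uniform in `s`. -/
theorem lintegral_crossCount_lastCut_le (hμ : μ.IsStable men p)
    (hp : ∀ v m, (p v).Accepts m ↔ m ∈ A v) (hD : ∀ v, IsRegular (D v) (A v))
    (h0 : ∀ v, D v (revealedEvent men A μ p v) ≠ 0) {w : Fin W} {x : Fin M}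
    (hx : μ.husband w = some x) :
    ∫⁻ q, crossCount (A w) x (lastCut (husbandIndex μ) (levelEvent A μ) x q) (q w)
        ∂(Measure.pi fun v => cond (D v) (revealedEvent men A μ p v)) ≤ oddsSum D A := by
  classical
  have : ∀ v, IsProbabilityMeasure (cond (D v) (revealedEvent men A μ p v)) := fun v =>
    cond_isProbabilityMeasure (h0 v)
  set ν := fun v => cond (D v) (revealedEvent men A μ p v) with hν
  let G := lastCut (husbandIndex μ) (levelEvent A μ) x
  have hdisj : Disjoint {v | husbandIndex μ v < x} {w} := by
    rw [Set.disjoint_singleton_right]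
    exact fun h => lt_irrefl _ (lt_of_eq_of_lt (husbandIndex_eq hx).symm h)
  have hG : ∀ s, DependsOn (· ∈ {q | G q = s}) {v | husbandIndex μ v < x} := by
    intro s q q' h
    simp only [Set.mem_ofPred_eq, G, dependsOn_lastCut _ _ _ h]
  have hterm : ∀ s, ∫⁻ q, {q | G q = s}.indicator 1 q * crossCount (A w) x s (q w)
      ∂(Measure.pi ν) ≤ Measure.pi ν {q | G q = s} * oddsSum D A := by
    intro s
    rw [lintegral_mul_of_dependsOn ν hdisj
      (dependsOn_indicator (hG s) (f := 1) (fun _ _ _ => rfl))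
      (fun q q' h => by rw [h w rfl]), lintegral_indicator_one MeasurableSet.of_discrete]
    gcongr
    rw [(measurePreserving_eval ν w).lintegral_comp (f := crossCount (A w) x s)
      Measurable.of_discrete]
    exact lintegral_crossCount_le hμ (hp w) (hD w) hx s
  have hmem : ∀ q, G q ∈ Finset.range ((x : ℕ) + 1) := fun q =>
    Finset.mem_range.2 (Nat.lt_succ_of_le (lastCut_le _ _ _ _))
  calc _ ≤ ∫⁻ q, ∑ s ∈ Finset.range ((x : ℕ) + 1),
        {q | G q = s}.indicator 1 q * crossCount (A w) x s (q w) ∂(Measure.pi ν) := by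
        refine lintegral_mono fun q => ?_
        refine le_trans ?_ (Finset.single_le_sum (fun _ _ => zero_le) (hmem q))
        rw [Set.indicator_of_mem (show q ∈ {q' | G q' = G q} from rfl), Pi.one_apply, one_mul]
    _ = ∑ s ∈ Finset.range ((x : ℕ) + 1), ∫⁻ q, {q | G q = s}.indicator 1 q *
          crossCount (A w) x s (q w) ∂(Measure.pi ν) :=
        lintegral_finsetSum _ fun _ _ => Measurable.of_discrete
    _ ≤ ∑ s ∈ Finset.range ((x : ℕ) + 1), Measure.pi ν {q | G q = s} * oddsSum D A :=
        Finset.sum_le_sum fun s _ => hterm s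
    _ = Measure.pi ν Set.univ * oddsSum D A := by
        rw [← Finset.sum_mul]
        congr 1
        have h := sum_measure_preimage_singleton (μ := Measure.pi ν) (f := G)
          (Finset.range ((x : ℕ) + 1)) (fun _ _ => MeasurableSet.of_discrete)
        refine h.trans (congrArg _ ?_)
        exact Set.eq_univ_of_forall fun q => Finset.mem_coe.2 (hmem q)
    _ = _ := by rw [measure_univ, one_mul]

theorem lintegral_stableRankGap_cond_le (hA : ∀ v, ∀ᵐ r ∂(D v), ∀ m, r.Accepts m ↔ m ∈ A v)
    (hμ : μ.IsStable men p) (hopt : μ.IsManOptimal men p)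
    (hp : ∀ v m, (p v).Accepts m ↔ m ∈ A v) (hD : ∀ v, IsRegular (D v) (A v))
    (hfin : ∀ k, maxOdds D A (k + 1) ≠ ∞)
    (h0 : Measure.pi D (Set.univ.pi (revealedEvent men A μ p)) ≠ 0) {w : Fin W} {x : Fin M}
    (hx : μ.husband w = some x) :
    ∫⁻ q, stableRankGap men q w
        ∂(cond (Measure.pi D) (Set.univ.pi (revealedEvent men A μ p))) ≤
      oddsSum D A + EReal.exp (oddsSum D A : EReal) * oddsSqSum D A + oddsSum D A := by
  rw [cond_pi_univ_pi D _ h0]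
  have h0' : ∀ v, D v (revealedEvent men A μ p v) ≠ 0 := by
    rw [Measure.pi_pi, Finset.prod_ne_zero_iff] at h0
    exact fun i => h0 i (Finset.mem_univ i)
  have : ∀ v, IsProbabilityMeasure (cond (D v) (revealedEvent men A μ p v)) := fun v =>
    cond_isProbabilityMeasure (h0' v)
  set ν := fun v => cond (D v) (revealedEvent men A μ p v) with hν
  have hgood : ∀ᵐ q ∂(Measure.pi ν), ∀ v,
      (∀ m, (q v).Accepts m ↔ m ∈ A v) ∧ q v ∈ revealedEvent men A μ p v := by
    rw [ae_all_iff]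
    intro v
    refine (measurePreserving_eval ν v).quasiMeasurePreserving.ae
      (p := fun r => (∀ m, r.Accepts m ↔ m ∈ A v) ∧ r ∈ revealedEvent men A μ p v) ?_
    have h1 : ∀ᵐ r ∂(ν v), ∀ m, r.Accepts m ↔ m ∈ A v := cond_absolutelyContinuous (hA v)
    exact h1.and (ae_cond_mem MeasurableSet.of_discrete)
  have hbound : ∀ᵐ q ∂(Measure.pi ν), stableRankGap men q w ≤ upperCount (A w) x (q w) +
      ((x - lastCut (husbandIndex μ) (levelEvent A μ) x q : ℕ) : ℝ≥0∞) +
      crossCount (A w) x (lastCut (husbandIndex μ) (levelEvent A μ) x q) (q w) := by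
    filter_upwards [hgood] with q hq
    have hq1 : ∀ v m, (q v).Accepts m ↔ m ∈ A v := fun v => (hq v).1
    have hq2 : ∀ v, PrefList.Agree (μ.proposers men v ∩ A v) (p v) (q v) := fun v => (hq v).2
    exact stableRankGap_le_counts hq1 (hμ.of_agree hp hq1 hq2) 
      (hopt.of_agree hp hq1 hμ hq2) hx
  refine (lintegral_mono_ae hbound).trans ?_
  rw [lintegral_add_left Measurable.of_discrete, lintegral_add_left Measurable.of_discrete]
  refine add_le_add (add_le_add ?_ ?_) ?_
  · rw [(measurePreserving_eval ν w).lintegral_comp (f := upperCount (A w) x)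
      Measurable.of_discrete]
    exact lintegral_upperCount_le hμ (hp w) (hD w) hx
  · exact lintegral_sub_lastCut_husbandIndex_le hμ hp hD hfin h0' x.2.le
  · exact lintegral_crossCount_lastCut_le hμ hp hD h0' hx

/-- Up to a null set, the event that `w` has a stable partner is a disjoint union of atoms of
revealed information, and the conditional bound holds on each atom of positive measure. -/
theorem setLIntegral_stableRankGap_le (hA : ∀ v, ∀ᵐ r ∂(D v), ∀ m, r.Accepts m ↔ m ∈ A v)
    (hD : ∀ v, IsRegular (D v) (A v)) (hfin : ∀ k, maxOdds D A (k + 1) ≠ ∞) (w : Fin W) :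
    ∫⁻ q in {q | (stablePartners men q w).Nonempty}, stableRankGap men q w ∂(Measure.pi D) ≤
      (oddsSum D A + EReal.exp (oddsSum D A : EReal) * oddsSqSum D A + oddsSum D A) *
        Measure.pi D {q | (stablePartners men q w).Nonempty} := by
  classical
  set C := oddsSum D A + EReal.exp (oddsSum D A : EReal) * oddsSqSum D A + oddsSum D A
  set S : Set (Fin W → PrefList M) := {q | (stablePartners men q w).Nonempty} with hS
  let good : Set (Fin W → PrefList M) := {q | ∀ v m, (q v).Accepts m ↔ m ∈ A v}
  have hgood : ∀ᵐ q ∂(Measure.pi D), q ∈ good := by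
    have h : ∀ᵐ q ∂(Measure.pi D), ∀ v, ∀ m, (q v).Accepts m ↔ m ∈ A v := by
      rw [ae_all_iff]
      exact fun v => (measurePreserving_eval D v).quasiMeasurePreserving.ae
        (p := fun r => ∀ m, r.Accepts m ↔ m ∈ A v) (hA v)
    exact h
  choose μ hμ hopt using fun q => exists_isStable_isManOptimal men q
  let atom : (Fin W → PrefList M) → Set (Fin W → PrefList M) := fun q =>
    Set.univ.pi (revealedEvent men A (μ q) q)
  -- The revealed orders determine the man-optimal matching, hence which men are revealed; so two
  -- atoms that meet in `good` coincide.
  have hatom : ∀ q ∈ good, ∀ q' ∈ good, q' ∈ atom q → μ q' = μ q ∧ atom q' = atom q := by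
    intro q hq q' hq' h
    have hag : ∀ v, PrefList.Agree ((μ q).proposers men v ∩ A v) (q v) (q' v) :=
      fun v => h v trivial
    have heq : μ q' = μ q := (hopt q').eq ((hopt q).of_agree hq hq' (hμ q) hag)
      (hμ q') ((hμ q).of_agree hq hq' hag)
    refine ⟨heq, ?_⟩
    simp only [atom, heq]
    congr 1
    funext v
    ext r
    exact ⟨fun hr a ha b hb => (hag v a ha b hb).trans (hr a ha b hb),
      fun hr a ha b hb => (hag v a ha b hb).symm.trans (hr a ha b hb)⟩
  have hself : ∀ q, q ∈ atom q := fun q v _ => PrefList.Agree.refl _ _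
  have hmatched : ∀ q, q ∈ S ↔ ∃ x, (μ q).husband w = some x := fun q =>
    ⟨fun h => (hopt q).exists_husband (hμ q) h, fun ⟨x, hx⟩ => ⟨x, μ q, hμ q, hx⟩⟩
  have hset : ∀ q ∈ S ∩ good, ((S ∩ good) ∩ atom ⁻¹' {atom q}) = atom q ∩ good := by
    intro q hq
    ext q'
    constructor
    · rintro ⟨⟨-, h1⟩, h2⟩
      refine ⟨?_, h1⟩
      have h3 : atom q' = atom q := h2
      rw [← h3]
      exact hself q'
    · rintro ⟨h1, h2⟩
      obtain ⟨h3, h4⟩ := hatom q hq.2 q' h2 h1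
      refine ⟨⟨?_, h2⟩, h4⟩
      rw [hmatched, h3, ← hmatched]
      exact hq.1
  have hSgood : (S ∩ good : Set (Fin W → PrefList M)) =ᵐ[Measure.pi D] S := by
    filter_upwards [hgood] with q hq
    refine propext ⟨fun h => h.1, fun h => ⟨h, hq⟩⟩
  have hpart : ∀ f : (Fin W → PrefList M) → ℝ≥0∞, ∫⁻ q in S, f q ∂(Measure.pi D) =
      ∑ k, ∫⁻ q in (S ∩ good) ∩ atom ⁻¹' {k}, f q ∂(Measure.pi D) := by
    intro f
    rw [← setLIntegral_congr hSgood,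
      ← lintegral_biUnion_finset _ (fun _ _ => MeasurableSet.of_discrete)]
    · congr 2
      ext q
      simp
    · intro k _ k' _ hkk
      exact Set.disjoint_left.2 fun q h h' => hkk (h.2.symm.trans h'.2)
  have hatomle : ∀ k, ∫⁻ q in (S ∩ good) ∩ atom ⁻¹' {k}, stableRankGap men q w ∂(Measure.pi D) ≤
      C * ∫⁻ q in (S ∩ good) ∩ atom ⁻¹' {k}, 1 ∂(Measure.pi D) := by
    intro k
    rcases ((S ∩ good) ∩ atom ⁻¹' {k}).eq_empty_or_nonempty with hem | ⟨q, hq, hk⟩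
    · rw [hem]; simp
    · have hk' : atom q = k := hk
      rw [← hk', hset q hq]
      have hae : (atom q ∩ good : Set (Fin W → PrefList M)) =ᵐ[Measure.pi D] atom q := by
        filter_upwards [hgood] with q' hq'
        refine propext ⟨fun h => h.1, fun h => ⟨h, hq'⟩⟩
      rw [setLIntegral_congr hae, setLIntegral_congr hae, setLIntegral_one]
      rcases eq_or_ne (Measure.pi D (atom q)) 0 with h0 | h0
      · rw [Measure.restrict_eq_zero.2 h0]
        simp
      · obtain ⟨x, hx⟩ := (hmatched q).1 hq.1
        have h := lintegral_stableRankGap_cond_le hA (hμ q) (hopt q) hq.2 hD hfin h0 hx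
        rw [ProbabilityTheory.cond, lintegral_smul_measure, smul_eq_mul] at h
        calc _ = ((Measure.pi D (atom q))⁻¹ *
              ∫⁻ q' in atom q, stableRankGap men q' w ∂(Measure.pi D)) *
              Measure.pi D (atom q) := by
              rw [mul_comm, ← mul_assoc, ENNReal.mul_inv_cancel h0 (measure_ne_top _ _), one_mul]
          _ ≤ _ := mul_le_mul_left h _
  have h1 := hpart 1
  simp only [Pi.one_apply, setLIntegral_one] at h1
  rw [hpart, h1, Finset.mul_sum]
  refine Finset.sum_le_sum fun k _ => ?_
  have := hatomle k
  rwa [setLIntegral_one] at this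

end Expectation

end StableMarriage

theorem theorem1 (M W : ℕ)
    (men : Fin M → StableMarriage.PrefList W)
    (A : Fin W → Set (Fin M))
    (D : Fin W → Measure (StableMarriage.PrefList M))
    [∀ w, IsProbabilityMeasure (D w)]
    (hA : ∀ w, ∀ᵐ p ∂(D w), ∀ m, p.Accepts m ↔ m ∈ A w)
    (hreg : ∀ w, StableMarriage.IsRegular (D w) (A w))
    (w : Fin W)
    (hw : Measure.pi D {women | (StableMarriage.stablePartners men women w).Nonempty} ≠ 0) :
    ∫⁻ women, StableMarriage.stableRankGap men women w
        ∂(cond (Measure.pi D) {women | (StableMarriage.stablePartners men women w).Nonempty}) ≤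
      (1 + 2 * EReal.exp ((∑' k : ℕ, ((k + 1 : ℕ) : ℝ≥0∞) * StableMarriage.maxOdds D A (k + 1) :
          ℝ≥0∞) : EReal)) *
        ∑' k : ℕ, ((k + 1 : ℕ) : ℝ≥0∞) ^ 2 * StableMarriage.maxOdds D A (k + 1) := by
  change _ ≤ (1 + 2 * EReal.exp ((StableMarriage.oddsSum D A : ℝ≥0∞) : EReal)) *
    StableMarriage.oddsSqSum D A
  by_cases hfin : ∀ k, StableMarriage.maxOdds D A (k + 1) ≠ ∞
  · rw [ProbabilityTheory.cond, lintegral_smul_measure, smul_eq_mul]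
    set S := {women | (StableMarriage.stablePartners men women w).Nonempty}
    set U := StableMarriage.oddsSum D A
    set K := StableMarriage.oddsSqSum D A
    have hU : U ≤ K := StableMarriage.oddsSum_le_oddsSqSum D A
    have hQ : 1 ≤ EReal.exp (U : EReal) := by
      rw [EReal.one_le_exp_iff]
      exact EReal.coe_ennreal_nonneg U
    calc _ ≤ (Measure.pi D S)⁻¹ * ((U + EReal.exp (U : EReal) * K + U) * Measure.pi D S) := by
          gcongr
          exact StableMarriage.setLIntegral_stableRankGap_le hA hreg hfin w
      _ = (U + EReal.exp (U : EReal) * K + U) * ((Measure.pi D S)⁻¹ * Measure.pi D S) := by ring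
      _ = U + EReal.exp (U : EReal) * K + U := by
          rw [ENNReal.inv_mul_cancel hw (measure_ne_top _ _), mul_one]
      -- The count above `x` is absorbed into `K`, and the count across the cut into `exp U * K`.
      _ ≤ 1 * K + EReal.exp (U : EReal) * K + EReal.exp (U : EReal) * K := by
          gcongr
          · rwa [one_mul]
          · exact hU.trans (le_mul_of_one_le_left' hQ)
      _ = _ := by ring
  -- An infinite `u_k` makes `∑ k² u_k` infinite, and the other factor is nonzero.
  · push Not at hfin
    obtain ⟨k, hk⟩ := hfin
    have hK : StableMarriage.oddsSqSum D A = ∞ := by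
      refine top_le_iff.1 (le_trans ?_ (ENNReal.le_tsum k))
      rw [hk, ENNReal.mul_top (by positivity)]
    rw [hK, ENNReal.mul_top (by simp)]
    exact le_top
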